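/- Let $d\ge 1$ and $p\ge 1$ be integers, and let $\alpha>2dp+1$, $C_J>0$, $\delta_0>0$ and $v>\kappa$ be real numbers. Then there is a constant $C>0$, depending only on $d,p,\alpha,C_J,\delta_0,v,\kappa$, such that the following holds. Let $\Lambda\subset\mathbb R^d$ be any finite set with $|x-y|\ge 1$ for all distinct $x,y\in\Lambda$, let $J=(J_{xy})_{x,y\in\Lambda}$ be any Hermitian matrix with $$|J_{xy}|\le C_J|x-y|^{-\alpha}\quad(x\ne y),\qquad \sup_{x\in\Lambda}\sum_{y\in\Lambda}|J_{xy}|\,|x-y|\le\kappa ,$$ and let $\Phi:\mathbb N_0^\Lambda\to\mathbb R$ be an arbitrary function. On the bosonic Fock space $\mathcal F(\ell^2(\Lambda))$, with annihilation and creation operators $a_x,a_x^*$ and $n_x=a_x^*a_x$, let $$H=\sum_{x,y\in\Lambda}J_{xy}a_x^*a_y+\Phi\big((n_x)_{x\in\Lambda}\big),\qquad \mathcal D(H)=\Big\{(\psi_N)_{N\ge0}:\ \sum_{N\ge0}\|H\psi_N\|^2<\infty\Big\},$$ where $\psi_N$ is the $N$-particle component. For $X\subset\Lambda$ let $N_X=\sum_{x\in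 X}n_x$, and let $B_h=\{x\in\Lambda:|x|\le h\}$. Let $\lambda,R,r>0$ with $R-r>\max(\delta_0 r,1)$. Let $\psi_0\in\mathcal D(H)$, $\|\psi_0\|=1$, let $\psi_t=e^{-iHt}\psi_0$ be the solution of $i\partial_t\psi_t=H\psi_t$, and write $\langle A\rangle_t=\langle\psi_t,A\psi_t\rangle$ (in the sense of quadratic forms, with values in $[0,\infty]$ if $A\ge 0$). If $$\langle N_X^p\rangle_0\le(\lambda|X|)^p\qquad\text{for all }X\subset\Lambda,$$ then $$\sup_{0\le t<(R-r)/v}\langle N_{B_r}^p\rangle_t\ \le\ \langle N_{B_R}^p\rangle_0+C(R-r)^{-1}\big(\langle N_{B_R}\rangle_0+\langle N_{B_R}^p\rangle_0\big)+C(\lambda+\lambda^p).$$ In particular, the bound is uniform in $\Lambda$, in the interaction $\Phi$ and in the particle number. -/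

import Mathlib

open scoped ENNReal

noncomputable section

namespace LatticeBosons

section Fock

variable {ι : Type*} [Fintype ι]

/-- The bosonic Fock space over `ℓ²(ι)` for a finite set `ι` of sites, in the occupation number
representation: the Hilbert space `ℓ²(ι → ℕ)`. The coordinate of a vector at `n : ι → ℕ` is its
coefficient with respect to the normalized symmetric state with `n x` particles at each site `x`;
the `N`-particle sector consists of the vectors supported on `{n | ∑ x, n x = N}`. -/
abbrev FockSpace (ι : Type*) : Type _ := lp (fun _ : ι → ℕ => ℂ) 2

open Classical in
/-- The annihilation operator `a_x`, acting on coefficient functions: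
`a_x |n⟩ = √(n x) |n - e_x⟩`, that is `(a_x ψ)(n) = √(n x + 1) ψ(n + e_x)`. -/
def annihilate (x : ι) : ((ι → ℕ) → ℂ) →ₗ[ℂ] ((ι → ℕ) → ℂ) where
  toFun ψ n := (Real.sqrt ((n x : ℝ) + 1) : ℂ) * ψ (Function.update n x (n x + 1))
  map_add' ψ φ := by ext n; simp [mul_add]
  map_smul' c ψ := by ext n; simp [mul_left_comm]

open Classical in
/-- The creation operator `a_x^*`, acting on coefficient functions:
`a_x^* |n⟩ = √(n x + 1) |n + e_x⟩`, that is `(a_x^* ψ)(n) = √(n x) ψ(n - e_x)`, which is `0`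
if `n x = 0`. -/
def create (x : ι) : ((ι → ℕ) → ℂ) →ₗ[ℂ] ((ι → ℕ) → ℂ) where
  toFun ψ n := (Real.sqrt (n x : ℝ) : ℂ) * ψ (Function.update n x (n x - 1))
  map_add' ψ φ := by ext n; simp [mul_add]
  map_smul' c ψ := by ext n; simp [mul_left_comm]

/-- The particle number operator `N_X = ∑_{x ∈ X} a_x^* a_x`, acting on coefficient functions. -/
def numberOp (X : Finset ι) : ((ι → ℕ) → ℂ) →ₗ[ℂ] ((ι → ℕ) → ℂ) :=
  ∑ x ∈ X, create x ∘ₗ annihilate x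

/-- The formal action of `∑_{x,y} J_{xy} a_x^* a_y + Φ((n_x)_x)` on coefficient functions. -/
def hamiltonianAction (J : Matrix ι ι ℂ) (Φ : (ι → ℕ) → ℝ) :
    ((ι → ℕ) → ℂ) →ₗ[ℂ] ((ι → ℕ) → ℂ) where
  toFun ψ n := ∑ x, ∑ y, J x y * create x (annihilate y ψ) n + (Φ n : ℂ) * ψ n
  map_add' ψ φ := by
    ext n
    simp only [map_add, Pi.add_apply, mul_add, Finset.sum_add_distrib]
    ring
  map_smul' c ψ := by
    ext n
    simp only [map_smul, Pi.smul_apply, smul_eq_mul, RingHom.id_apply, mul_add, Finset.mul_sum]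
    congr 1
    · exact Finset.sum_congr rfl fun x _ => Finset.sum_congr rfl fun y _ => by ring
    · ring

/-- The Hamiltonian `H = ∑_{x,y} J_{xy} a_x^* a_y + Φ((n_x)_x)` as an unbounded operator on Fock
space, with its maximal domain. Since `H` preserves the (finite dimensional) particle number
sectors, the domain consists of the `ψ = (ψ_N)_N` with `∑_N ‖H ψ_N‖² < ∞`. -/
def hamiltonian (J : Matrix ι ι ℂ) (Φ : (ι → ℕ) → ℝ) : FockSpace ι →ₗ.[ℂ] FockSpace ι where
  domain :=
    { carrier := {ψ | Memℓp (hamiltonianAction J Φ ⇑ψ) 2}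
      zero_mem' := by
        simp only [Set.mem_ofPred_eq, lp.coeFn_zero, map_zero]
        exact zero_memℓp
      add_mem' := by
        intro ψ φ hψ hφ
        simp only [Set.mem_ofPred_eq, lp.coeFn_add, map_add] at *
        exact hψ.add hφ
      smul_mem' := by
        intro c ψ hψ
        simp only [Set.mem_ofPred_eq, lp.coeFn_smul, map_smul] at *
        exact hψ.const_smul c }
  toFun :=
    { toFun := fun ψ => ⟨hamiltonianAction J Φ ⇑(ψ : FockSpace ι), ψ.2⟩
      map_add' := by
        intro ψ φ
        ext1
        simp only [Submodule.coe_add, lp.coeFn_add, map_add]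
      map_smul' := by
        intro c ψ
        ext1
        simp only [Submodule.coe_smul, lp.coeFn_smul, map_smul, RingHom.id_apply] }

/-- `ψ` is the solution `ψ_t = e^{-iHt} ψ_0` of the Schrödinger equation `i ∂_t ψ_t = H ψ_t`, in
the strong sense: `ψ_t` lies in the domain of `H` and `∂_t ψ_t = -i H ψ_t` in norm, for all `t`. -/
def IsSchrodingerSolution (H : FockSpace ι →ₗ.[ℂ] FockSpace ι) (ψ : ℝ → FockSpace ι) : Prop :=
  ∀ t : ℝ, ∃ ht : ψ t ∈ H.domain, HasDerivAt ψ (-(Complex.I • H ⟨ψ t, ht⟩)) t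

/-- The expectation `⟨ψ, N_X^p ψ⟩ ∈ [0, ∞]`, in the sense of quadratic forms. As `N_X` is the
multiplication by `∑_{x ∈ X} n x`, it is `∑_n (∑_{x ∈ X} n x)^p |ψ(n)|²`, and it is finite if and
only if `ψ` lies in the domain of `N_X^{p/2}`. -/
def numberMoment (X : Finset ι) (p : ℕ) (ψ : FockSpace ι) : ℝ≥0∞ :=
  ∑' n : ι → ℕ, ((∑ x ∈ X, n x : ℕ) : ℝ≥0∞) ^ p * ‖ψ n‖ₑ ^ 2

theorem create_annihilate_apply {ι : Type*} (x : ι) (ψ : (ι → ℕ) → ℂ) (n : ι → ℕ) :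
    create x (annihilate x ψ) n = (n x : ℂ) * ψ n := by
  rcases Nat.eq_zero_or_pos (n x) with h | h
  · simp [create, h]
  · have h1 : n x - 1 + 1 = n x := Nat.sub_add_cancel h
    have h2 : ((n x - 1 : ℕ) : ℝ) + 1 = n x := by exact_mod_cast h1
    simp only [create, annihilate, LinearMap.coe_mk, AddHom.coe_mk, Function.update_self,
      Function.update_idem, h1, h2, Function.update_eq_self, ← mul_assoc]
    rw [← Complex.ofReal_mul, Real.mul_self_sqrt (Nat.cast_nonneg _), Complex.ofReal_natCast]

/-- `N_X^p` is the multiplication by `(∑_{x ∈ X} n x)^p`. -/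
theorem numberOp_pow_apply {ι : Type*} (X : Finset ι) (p : ℕ) (ψ : (ι → ℕ) → ℂ) (n : ι → ℕ) :
    (numberOp X ^ p) ψ n = ((∑ x ∈ X, n x : ℕ) : ℂ) ^ p * ψ n := by
  induction p generalizing ψ with
  | zero => simp
  | succ p ih =>
    rw [pow_succ, Module.End.mul_apply, ih]
    simp [numberOp, create_annihilate_apply, ← Finset.sum_mul, pow_succ, mul_assoc]

end Fock

section Lattice

variable {d : ℕ} (Λ : Finset (EuclideanSpace ℝ (Fin d)))

/-- The ball `B_h = {x ∈ Λ : |x| ≤ h}`. -/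
def latticeBall (h : ℝ) : Finset Λ :=
  Finset.univ.filter fun x => ‖(x : EuclideanSpace ℝ (Fin d))‖ ≤ h

/-- The first moment `sup_{x ∈ Λ} ∑_{y ∈ Λ} |J_{xy}| |x - y|` of the hopping matrix
(a supremum over a finite set; it is `0` for empty `Λ`). -/
def hoppingSpeed (J : Matrix Λ Λ ℂ) : ℝ :=
  ⨆ x : Λ, ∑ y : Λ, ‖J x y‖ * dist x y

end Lattice

end LatticeBosons

end

/-!
The proof constructs a time-dependent weight whose `p`-th moment does not increase at all along the
evolution, and compares it with the moments of the two balls.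

Write `N_f = ∑_x f(x) n_x`. For a real function `G` of the occupation numbers, `i[H, G]` does not
see the interaction, and by antisymmetrizing and applying Young's inequality to
`⟨a_x ψ, a_y ψ⟩` its quadratic form is bounded by the classical jump process in which each of the
`n_x` particles at `x` jumps to `y` at rate `|J_xy|`, with absolute values of the increments of `G`
(`sum_sector_inner_hamiltonian_le`). Since `H` preserves the particle number, this is a computation
with finite sums in each sector, so no question of domains arises, and a supersolution `G_t` of the
jump process has nonincreasing expectation (`antitone_sum_sector`).

The supersolution is `G_t = N_{f_t}^p`, where `f_t(x) = F((|x| + v' t - u₀) / L)` and `F` is a step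
profile with tails `|u|^(-b)`, moving inwards with a speed `v'` strictly between `κ` and `v`. A jump
of length `ρ` changes `N_f^p` by at most `p N_f^(p-1)` times the slope of the profile at the
starting point times `θ ρ + C ρ^(p b + 1)`, with `θ` as close to `1` as desired
(`exists_profile_increment_bound`): short jumps see an almost constant slope, and for long ones the
polynomial tails lose only a power of `ρ`; since the jumping particle itself contributes to `N_f`,
lower order terms in `N_f` are absorbed as well. After rescaling by a large constant `L`, the
gain `v'` from the motion of the profile dominates the first moment `κ` of the hopping plus the
small remainder (`exists_scale`), because the moment of order `p b + 1` of the hopping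
is bounded uniformly in `Λ`. This needs `p b + 1 + d < α`.

The weight at time `0` is everywhere at most `1 + O((R - r)⁻¹)` times its minimum on `B_r` at the
later times in question, and outside `B_R` its sum is `O((R - r)^(-(p-1)/p))` as soon as
`b - (p-1)/p > d` (`exists_sum_profile_le`). Convexity then splits `N_f^p` into the part
in `B_R`, with a factor `1 + O((R - r)⁻¹)`, and the part outside, which is bounded by the on-site moments
(`tsum_weightedNumber_le_add`). Both conditions on `b` can be met because
`p d + p + d ≤ 2 d p + 1 < α` (`exists_exponent`).
-/

open scoped ENNReal

noncomputable section

namespace LatticeBosons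

/-! ### A step profile with polynomial tails -/

/-- The decreasing step profile `F_b`: it is `(1 + u)^(-b)` for `u ≥ 0` and `2 - (1 - u)^(-b)` for
`u < 0`, so that it drops from `2` to `0` and its slope `F_b'` is even. -/
def profile (b u : ℝ) : ℝ := if 0 ≤ u then (1 + u) ^ (-b) else 2 - (1 - u) ^ (-b)

/-- The slope `-F_b'(u) = b (1 + |u|)^(-b-1)` of the step profile. -/
def profileSlope (b u : ℝ) : ℝ := b * (1 + |u|) ^ (-b - 1)

theorem hasDerivAt_profile (b u : ℝ) : HasDerivAt (profile b) (-profileSlope b u) u := by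
  have hR : ∀ u : ℝ, 0 ≤ u → HasDerivAt (fun u : ℝ => (1 + u) ^ (-b)) (-profileSlope b u) u := by
    intro u hu
    have h1 : HasDerivAt (fun u : ℝ => 1 + u) 1 u := (hasDerivAt_id u).const_add 1
    have h2 := h1.rpow_const (p := -b) (Or.inl (by positivity))
    refine h2.congr_deriv ?_
    rw [profileSlope, abs_of_nonneg hu]; ring
  have hL : ∀ u : ℝ, u ≤ 0 → HasDerivAt (fun u : ℝ => 2 - (1 - u) ^ (-b)) (-profileSlope b u)
      u := by
    intro u hu
    have h1 : HasDerivAt (fun u : ℝ => 1 - u) (-1) u := (hasDerivAt_id u).const_sub 1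
    have h2 := (h1.rpow_const (p := -b) (Or.inl (by linarith))).const_sub 2
    refine h2.congr_deriv ?_
    rw [profileSlope, abs_of_nonpos hu, ← sub_eq_add_neg 1 u]; ring
  have hIci : ∀ y ∈ Set.Ici (0 : ℝ), profile b y = (1 + y) ^ (-b) := fun y hy => if_pos hy
  have hIic : ∀ y ∈ Set.Iic (0 : ℝ), profile b y = 2 - (1 - y) ^ (-b) := by
    intro y hy
    rcases (Set.mem_Iic.mp hy).lt_or_eq with h | rfl
    · exact if_neg (not_le.mpr h)
    · norm_num [profile]
  rcases lt_trichotomy u 0 with h | rfl | h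
  · refine (hL u h.le).congr_of_eventuallyEq ?_
    filter_upwards [Iio_mem_nhds h] with y hy using hIic y (Set.mem_Iio.mp hy).le
  · have h1 := ((hR 0 le_rfl).hasDerivWithinAt (s := Set.Ici 0)).congr hIci
      (hIci 0 Set.self_mem_Ici)
    have h2 := ((hL 0 le_rfl).hasDerivWithinAt (s := Set.Iic 0)).congr hIic
      (hIic 0 Set.self_mem_Iic)
    have h3 := h2.union h1
    rwa [Set.Iic_union_Ici, hasDerivWithinAt_univ] at h3
  · refine (hR u h.le).congr_of_eventuallyEq ?_
    filter_upwards [Ioi_mem_nhds h] with y hy using hIci y (Set.mem_Ioi.mp hy).le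

section Profile

variable {b : ℝ}

theorem profileSlope_pos (hb : 1 ≤ b) (u : ℝ) : 0 < profileSlope b u := by
  unfold profileSlope; positivity

theorem profile_antitone (hb : 1 ≤ b) : Antitone (profile b) :=
  antitone_of_deriv_nonpos (fun u => (hasDerivAt_profile b u).differentiableAt) fun u => by
    rw [(hasDerivAt_profile b u).deriv]; linarith [profileSlope_pos hb u]

theorem rpow_neg_le_profile (hb : 1 ≤ b) (u : ℝ) : (1 + max u 0) ^ (-b) ≤ profile b u := by
  rcases le_total 0 u with h | h
  · rw [profile, if_pos h, max_eq_left h]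
  · have := profile_antitone hb h
    simpa [max_eq_right h, profile] using this

theorem profile_pos (hb : 1 ≤ b) (u : ℝ) : 0 < profile b u :=
  (Real.rpow_pos_of_pos (by positivity) _).trans_le (rpow_neg_le_profile hb u)

theorem profile_le (b u : ℝ) : profile b u ≤ 2 * (1 + max u 0) ^ (-b) := by
  rcases le_or_gt 0 u with h | h
  · rw [profile, if_pos h, max_eq_left h]
    have : 0 ≤ (1 + u) ^ (-b) := by positivity
    linarith
  · rw [profile, if_neg (not_le.mpr h), max_eq_right h.le]
    have : 0 ≤ (1 - u) ^ (-b) := Real.rpow_nonneg (by linarith) _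
    simp [this]

theorem profile_le_two (hb : 1 ≤ b) (u : ℝ) : profile b u ≤ 2 := by
  refine (profile_le b u).trans ?_
  have : (1 + max u 0) ^ (-b) ≤ 1 :=
    Real.rpow_le_one_of_one_le_of_nonpos (by linarith [le_max_right u 0]) (by linarith)
  linarith

/-- The profile varies at most polynomially: `F(c) ≤ 2 (1 + |a - c|)^b F(a)`. -/
theorem profile_le_mul_profile (hb : 1 ≤ b) (a c : ℝ) :
    profile b c ≤ 2 * (1 + |a - c|) ^ b * profile b a := by
  refine (profile_le b c).trans ?_
  rw [mul_assoc]
  refine mul_le_mul_of_nonneg_left ?_ zero_le_two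
  have h0 : (1 + |a - c|) ^ b * (1 + max a 0) ^ (-b) ≤ (1 + |a - c|) ^ b * profile b a :=
    mul_le_mul_of_nonneg_left (rpow_neg_le_profile hb a) (by positivity)
  refine le_trans ?_ h0
  have hA : (0 : ℝ) < 1 + max a 0 := by positivity
  have hC : (0 : ℝ) < 1 + max c 0 := by positivity
  rw [Real.rpow_neg hA.le, Real.rpow_neg hC.le, ← div_eq_mul_inv, ← one_div,
    div_le_div_iff₀ (by positivity) (by positivity), one_mul,
    ← Real.mul_rpow (by positivity) hC.le]
  refine Real.rpow_le_rpow hA.le ?_ (by linarith)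
  have h1 : max a 0 ≤ max c 0 + |a - c| := by
    refine max_le ?_ (by positivity)
    linarith [le_abs_self (a - c), le_max_left c 0]
  nlinarith [abs_nonneg (a - c), le_max_right c 0]

theorem abs_profile_sub_le_two (hb : 1 ≤ b) (a c : ℝ) : |profile b a - profile b c| ≤ 2 :=
  abs_le.mpr ⟨by linarith [profile_pos hb a, profile_le_two hb c],
    by linarith [profile_pos hb c, profile_le_two hb a]⟩

theorem profileSlope_le (hb : 1 ≤ b) (a : ℝ) : profileSlope b a ≤ b * profile b a := by
  refine mul_le_mul_of_nonneg_left ?_ (by linarith)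
  refine le_trans ?_ (rpow_neg_le_profile hb a)
  have h1 : (1 + |a|) ^ (-b - 1) ≤ (1 + |a|) ^ (-b) :=
    Real.rpow_le_rpow_of_exponent_le (by linarith [abs_nonneg a]) (by linarith)
  refine h1.trans (Real.rpow_le_rpow_of_nonpos (by positivity) ?_ (by linarith))
  linarith [max_le (le_abs_self a) (abs_nonneg a)]

/-- If the slope grows by at most a factor `q` between `a` and `c`, so does the increment. -/
theorem abs_profile_sub_le_of_slope {q a c : ℝ} (hb : 1 ≤ b) (hq : 0 < q)
    (h : ∀ x : ℝ, |a - x| ≤ |a - c| → 1 + |a| ≤ q * (1 + |x|)) :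
    |profile b a - profile b c| ≤ q ^ (b + 1) * profileSlope b a * |a - c| := by
  have key := (convex_uIcc a c).norm_image_sub_le_of_norm_hasDerivWithin_le (f := profile b)
    (f' := fun u => -profileSlope b u) (C := q ^ (b + 1) * profileSlope b a)
    (fun x _ => (hasDerivAt_profile b x).hasDerivWithinAt) ?_ Set.right_mem_uIcc Set.left_mem_uIcc
  · simpa [Real.norm_eq_abs] using key
  · intro x hx
    have hx' : |a - x| ≤ |a - c| := by
      rw [abs_sub_comm a x, abs_sub_comm a c]; exact Set.abs_sub_left_of_mem_uIcc hx
    rw [norm_neg, Real.norm_of_nonneg (profileSlope_pos hb x).le, profileSlope, profileSlope,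
      mul_left_comm]
    refine mul_le_mul_of_nonneg_left ?_ (by linarith)
    have e : -b - 1 = -(b + 1) := by ring
    rw [e, Real.rpow_neg (by positivity), Real.rpow_neg (by positivity), ← div_eq_mul_inv,
      ← one_div, div_le_div_iff₀ (by positivity) (by positivity), one_mul,
      ← Real.mul_rpow hq.le (by positivity)]
    exact Real.rpow_le_rpow (by positivity) (h x hx') (by linarith)

theorem abs_profile_sub_le_near (hb : 1 ≤ b) (a c : ℝ) :
    |profile b a - profile b c| ≤ (1 + |a - c|) ^ (b + 1) * profileSlope b a * |a - c| := by
  refine abs_profile_sub_le_of_slope hb (by positivity) fun x hx => ?_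
  have : |a| ≤ |x| + |a - x| := by simpa using abs_add_le x (a - x)
  nlinarith [abs_nonneg x, abs_nonneg (a - c)]

theorem abs_profile_sub_le_far (hb : 1 ≤ b) (a c : ℝ) :
    |profile b a - profile b c| ≤
      2 * 2 ^ (b + 1) * profileSlope b a * (|a - c| + |a - c| ^ (b + 1)) := by
  have hw := profileSlope_pos hb a
  have h2 : (0 : ℝ) < 2 ^ (b + 1) := by positivity
  have hρ := abs_nonneg (a - c)
  have hρ' : 0 ≤ |a - c| ^ (b + 1) := by positivity
  rcases le_or_gt (2 * |a - c|) (1 + |a|) with h | h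
  · have := abs_profile_sub_le_of_slope (q := 2) (a := a) (c := c) hb two_pos fun x hx => by
      have : |a| ≤ |x| + |a - x| := by simpa using abs_add_le x (a - x)
      linarith
    refine this.trans ?_
    have h3 : 0 < 2 ^ (b + 1) * profileSlope b a := by positivity
    nlinarith [mul_nonneg h3.le hρ, mul_nonneg h3.le hρ']
  · -- a jump longer than the distance to the step: the total drop is already small enough
    refine (abs_profile_sub_le_two hb a c).trans ?_
    have h4 : 1 ≤ 2 ^ (b + 1) * profileSlope b a * |a - c| ^ (b + 1) := by
      have e : -b - 1 = -(b + 1) := by ring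
      have h5 : 1 ≤ 2 ^ (b + 1) * (1 + |a|) ^ (-b - 1) * |a - c| ^ (b + 1) := by
        rw [e, Real.rpow_neg (by positivity), mul_right_comm, ← div_eq_mul_inv,
          one_le_div (by positivity), ← Real.mul_rpow two_pos.le hρ]
        exact Real.rpow_le_rpow (by positivity) h.le (by linarith)
      calc 1 ≤ b * (2 ^ (b + 1) * (1 + |a|) ^ (-b - 1) * |a - c| ^ (b + 1)) := by nlinarith
        _ = _ := by rw [profileSlope]; ring
    have h6 : 0 ≤ 2 ^ (b + 1) * profileSlope b a * |a - c| := by positivity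
    nlinarith

/-- The increment of the profile, weighted by the factor it costs in a `p`-th power, is at most
the slope at the starting point times a function of the length of the jump that is almost linear
for short jumps and grows like the power `p b + 1`. -/
theorem exists_profile_increment_bound (hb : 1 ≤ b) {p : ℕ} (hp : 1 ≤ p) {θ : ℝ} (hθ : 1 < θ) :
    ∃ C : ℝ, 0 < C ∧ ∀ a c : ℝ,
      |profile b a - profile b c| * (1 + |profile b a - profile b c| / profile b a) ^ (p - 1) ≤
        profileSlope b a * (θ * |a - c| + C * |a - c| ^ (p * b + 1)) := by
  obtain ⟨η, hη0, hη⟩ : ∃ η : ℝ, 0 < η ∧ ∀ ρ : ℝ, 0 ≤ ρ → ρ < η →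
      (1 + ρ) ^ (b + 1) * (1 + b * ((1 + ρ) ^ (b + 1) * ρ)) ^ (p - 1) ≤ θ := by
    have hb1 : (0 : ℝ) ≤ b + 1 := by linarith
    have hc : Continuous fun ρ : ℝ =>
        (1 + ρ) ^ (b + 1) * (1 + b * ((1 + ρ) ^ (b + 1) * ρ)) ^ (p - 1) := by
      have : Continuous fun ρ : ℝ => (1 + ρ) ^ (b + 1) :=
        (continuous_const.add continuous_id).rpow_const fun _ => Or.inr hb1
      fun_prop
    have h0 : (fun ρ : ℝ => (1 + ρ) ^ (b + 1) * (1 + b * ((1 + ρ) ^ (b + 1) * ρ)) ^ (p - 1)) 0 <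
        θ := by
      simpa using hθ
    obtain ⟨η, hη, h⟩ := Metric.eventually_nhds_iff.mp (hc.continuousAt.eventually (gt_mem_nhds h0))
    exact ⟨η, hη, fun ρ h0 h1 => (h (by simpa [abs_of_nonneg h0] using h1)).le⟩
  set C1 : ℝ := 2 * 2 ^ (b + 1) * ((η⁻¹) ^ b + 1)
  set C2 : ℝ := (3 * (η⁻¹ + 1) ^ b) ^ (p - 1)
  refine ⟨C1 * C2, by positivity, fun a c => ?_⟩
  have hF := profile_pos hb a
  have hw := profileSlope_pos hb a
  set ρ := |a - c|
  have hρ : 0 ≤ ρ := abs_nonneg _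
  set Δ := |profile b a - profile b c|
  have hΔ : 0 ≤ Δ := abs_nonneg _
  rcases lt_or_ge ρ η with h | h
  · have h1 : Δ ≤ (1 + ρ) ^ (b + 1) * profileSlope b a * ρ := abs_profile_sub_le_near hb a c
    have h2 : Δ / profile b a ≤ b * ((1 + ρ) ^ (b + 1) * ρ) := by
      rw [div_le_iff₀ hF]
      refine h1.trans ?_
      have := mul_le_mul_of_nonneg_left (profileSlope_le hb a)
        (show 0 ≤ (1 + ρ) ^ (b + 1) * ρ by positivity)
      nlinarith
    calc Δ * (1 + Δ / profile b a) ^ (p - 1)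
        ≤ ((1 + ρ) ^ (b + 1) * profileSlope b a * ρ) *
            (1 + b * ((1 + ρ) ^ (b + 1) * ρ)) ^ (p - 1) := by gcongr
      _ = profileSlope b a * ρ *
            ((1 + ρ) ^ (b + 1) * (1 + b * ((1 + ρ) ^ (b + 1) * ρ)) ^ (p - 1)) := by ring
      _ ≤ profileSlope b a * ρ * θ := mul_le_mul_of_nonneg_left (hη ρ hρ h) (by positivity)
      _ ≤ profileSlope b a * (θ * ρ + C1 * C2 * ρ ^ (p * b + 1)) := by
          have : 0 ≤ profileSlope b a * (C1 * C2 * ρ ^ (p * b + 1)) := by positivity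
          nlinarith
  · have hρ0 : 0 < ρ := hη0.trans_le h
    have hηρ : 1 ≤ η⁻¹ * ρ := by rw [inv_mul_eq_div, one_le_div hη0]; exact h
    have h1 : Δ ≤ C1 * profileSlope b a * ρ ^ (b + 1) := by
      refine (abs_profile_sub_le_far hb a c).trans ?_
      have h3 : ρ ≤ (η⁻¹) ^ b * ρ ^ (b + 1) := by
        rw [Real.rpow_add_one hρ0.ne', ← mul_assoc, ← Real.mul_rpow (by positivity) hρ]
        have := Real.one_le_rpow hηρ (show 0 ≤ b by linarith)
        nlinarith
      calc 2 * 2 ^ (b + 1) * profileSlope b a * (ρ + ρ ^ (b + 1))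
          ≤ 2 * 2 ^ (b + 1) * profileSlope b a * ((η⁻¹) ^ b * ρ ^ (b + 1) + ρ ^ (b + 1)) := by
            gcongr
        _ = C1 * profileSlope b a * ρ ^ (b + 1) := by simp only [C1]; ring
    have h2 : 1 + Δ / profile b a ≤ 3 * (η⁻¹ + 1) ^ b * ρ ^ b := by
      have h4 : Δ ≤ 2 * (1 + ρ) ^ b * profile b a := by
        have h5 := profile_le_mul_profile hb a c
        have h6 : 1 ≤ (1 + ρ) ^ b := Real.one_le_rpow (by linarith) (by linarith)
        refine abs_le.mpr ⟨?_, ?_⟩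
        · linarith
        · have := profile_pos hb c
          nlinarith
      have h5 : Δ / profile b a ≤ 2 * (1 + ρ) ^ b := by rwa [div_le_iff₀ hF]
      have h6 : 1 ≤ (1 + ρ) ^ b := Real.one_le_rpow (by linarith) (by linarith)
      have h7 : (1 + ρ) ^ b ≤ (η⁻¹ + 1) ^ b * ρ ^ b := by
        rw [← Real.mul_rpow (by positivity) hρ]
        exact Real.rpow_le_rpow (by positivity) (by linarith) (by linarith)
      linarith
    have hpb : ρ ^ (b + 1) * (ρ ^ b) ^ (p - 1) = ρ ^ (p * b + 1) := by
      rw [← Real.rpow_natCast, ← Real.rpow_mul hρ, ← Real.rpow_add hρ0, Nat.cast_sub hp]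
      congr 1; push_cast; ring
    calc Δ * (1 + Δ / profile b a) ^ (p - 1)
        ≤ (C1 * profileSlope b a * ρ ^ (b + 1)) * (3 * (η⁻¹ + 1) ^ b * ρ ^ b) ^ (p - 1) := by
          gcongr
      _ = profileSlope b a * (C1 * C2 * (ρ ^ (b + 1) * (ρ ^ b) ^ (p - 1))) := by
          simp only [C2]; rw [mul_pow _ (ρ ^ b)]; ring
      _ = profileSlope b a * (C1 * C2 * ρ ^ (p * b + 1)) := by rw [hpb]
      _ ≤ profileSlope b a * (θ * ρ + C1 * C2 * ρ ^ (p * b + 1)) := by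
          have : 0 ≤ θ * ρ := by positivity
          gcongr; linarith

end Profile

/-! ### Power sums over separated sets -/

open MeasureTheory in
/-- Power sums over a `1`-separated set, with exponent above the dimension, are bounded uniformly
in the set and in the centre: the balls of radius `1/2` around the points are disjoint, so the sum
is dominated by the integral of `(1 + |y|)^(-β)`. -/
theorem exists_sum_dist_rpow_le (d : ℕ) {β : ℝ} (hβ : (d : ℝ) < β) :
    ∃ S : ℝ, 0 < S ∧ ∀ A : Finset (EuclideanSpace ℝ (Fin d)),
      (∀ x ∈ A, ∀ y ∈ A, x ≠ y → 1 ≤ dist x y) → ∀ z : EuclideanSpace ℝ (Fin d),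
      (∀ x ∈ A, 1 ≤ dist x z) → ∑ x ∈ A, dist x z ^ (-β) ≤ S := by
  set E := EuclideanSpace ℝ (Fin d)
  have hβ0 : 0 < β := (Nat.cast_nonneg d).trans_lt hβ
  have hint : Integrable (fun y : E => (1 + ‖y‖) ^ (-β)) :=
    integrable_one_add_norm (by simpa [E] using hβ)
  set I : ℝ := ∫ y : E, (1 + ‖y‖) ^ (-β)
  set V : ℝ := volume.real (Metric.ball (0 : E) (1 / 2))
  have hV : 0 < V :=
    ENNReal.toReal_pos (Metric.measure_ball_pos volume _ (by norm_num)).ne' measure_ball_lt_top.ne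
  have hI : 0 ≤ I := integral_nonneg fun y => by positivity
  refine ⟨3 ^ β * I / V + 1, by positivity, fun A hA z hz => ?_⟩
  have hintz : Integrable (fun y : E => (1 + ‖y - z‖) ^ (-β)) := hint.comp_sub_right z
  have hIz : ∫ y : E, (1 + ‖y - z‖) ^ (-β) = I :=
    integral_sub_right_eq_self (fun y : E => (1 + ‖y‖) ^ (-β)) z
  have hpt : ∀ x ∈ A, V * dist x z ^ (-β) ≤
      3 ^ β * ∫ y in Metric.ball x (1 / 2), (1 + ‖y - z‖) ^ (-β) := by
    intro x hx
    have hVx : volume.real (Metric.ball x (1 / 2)) = V := by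
      simp only [V, Measure.real, Measure.addHaar_ball_center volume x]
    rw [← hVx, ← integral_const_mul, ← smul_eq_mul, ← setIntegral_const]
    refine setIntegral_mono_on (integrableOn_const measure_ball_lt_top.ne)
      (hintz.integrableOn.const_mul _) measurableSet_ball fun y hy => ?_
    have h1 : (1 + ‖y - z‖) ≤ 3 * dist x z := by
      have h2 := hz x hx
      have h3 : dist y x < 1 / 2 := hy
      have h4 := dist_triangle y x z
      rw [← dist_eq_norm]; linarith
    have hd : 0 < dist x z := by linarith [hz x hx]
    have h5 : (3 * dist x z) ^ (-β) ≤ (1 + ‖y - z‖) ^ (-β) :=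
      Real.rpow_le_rpow_of_nonpos (by positivity) h1 (by linarith)
    rw [Real.mul_rpow (by norm_num) hd.le, Real.rpow_neg (by norm_num), inv_mul_eq_div,
      div_le_iff₀ (by positivity)] at h5
    linarith
  have hdisj : (A : Set E).Pairwise
      (Function.onFun Disjoint fun x => Metric.ball x (1 / 2 : ℝ)) := by
    intro x hx y hy hxy
    exact Metric.ball_disjoint_ball (by linarith [hA x hx y hy hxy])
  have hsum : ∑ x ∈ A, ∫ y in Metric.ball x (1 / 2), (1 + ‖y - z‖) ^ (-β) ≤ I := by
    rw [← integral_biUnion_finset A (fun x _ => measurableSet_ball) hdisj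
      fun x _ => hintz.integrableOn, ← hIz]
    exact setIntegral_le_integral hintz (ae_of_all _ fun y => by positivity)
  have : V * ∑ x ∈ A, dist x z ^ (-β) ≤ 3 ^ β * I := by
    rw [Finset.mul_sum]
    refine (Finset.sum_le_sum hpt).trans ?_
    rw [← Finset.mul_sum]
    gcongr
  have h7 : ∑ x ∈ A, dist x z ^ (-β) ≤ 3 ^ β * I / V := by
    rw [le_div_iff₀ hV]; linarith
  linarith

/-! ### Moment inequalities along the Schrödinger evolution -/

section Dynamics

variable {ι : Type*}

/-- The occupation numbers `n ∈ ℕ^ι` of total particle number `N`, a finite set. -/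
def sector (ι : Type*) [Fintype ι] [DecidableEq ι] (N : ℕ) : Finset (ι → ℕ) :=
  Finset.univ.piAntidiag N

theorem mem_sector [Fintype ι] [DecidableEq ι] {N : ℕ} {n : ι → ℕ} :
    n ∈ sector ι N ↔ ∑ x, n x = N := by
  simp [sector]

theorem annihilate_apply [DecidableEq ι] (x : ι) (ψ : (ι → ℕ) → ℂ) (k : ι → ℕ) :
    annihilate x ψ k = (Real.sqrt ((k x : ℝ) + 1) : ℂ) * ψ (k + Pi.single x 1) := by
  have : Function.update k x (k x + 1) = k + Pi.single x 1 := by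
    ext z; by_cases h : z = x
    · subst h; simp
    · simp [h]
  rw [← this]
  simp only [annihilate, LinearMap.coe_mk, AddHom.coe_mk]
  congr!

theorem create_apply_of_eq_zero {x : ι} {n : ι → ℕ} (h : n x = 0) (φ : (ι → ℕ) → ℂ) :
    create x φ n = 0 := by
  simp [create, h]

theorem create_apply_add_single [DecidableEq ι] (x : ι) (φ : (ι → ℕ) → ℂ) (k : ι → ℕ) :
    create x φ (k + Pi.single x 1) = (Real.sqrt ((k x : ℝ) + 1) : ℂ) * φ k := by
  simp only [create, LinearMap.coe_mk, AddHom.coe_mk, Pi.add_apply, Pi.single_eq_same,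
    Nat.cast_add, Nat.cast_one, Nat.add_sub_cancel]
  congr 2
  ext z
  by_cases h : z = x
  · subst h; simp
  · simp [h]

theorem single_add_tsub [DecidableEq ι] {x : ι} {n : ι → ℕ} (h : n x ≠ 0) :
    n - Pi.single x 1 + Pi.single x 1 = n := by
  ext z; by_cases hz : z = x
  · subst hz; simp; omega
  · simp [hz]

/-- Removing a particle at `x` identifies the configurations of `N + 1` particles that occupy `x`
with all configurations of `N` particles. -/
theorem sum_sector_succ [Fintype ι] [DecidableEq ι] {M : Type*} [AddCommMonoid M]
    (N : ℕ) (x : ι) (φ : (ι → ℕ) → M)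
    (hφ : ∀ n : ι → ℕ, n x = 0 → φ n = 0) :
    ∑ n ∈ sector ι (N + 1), φ n = ∑ k ∈ sector ι N, φ (k + Pi.single x 1) := by
  symm
  refine Finset.sum_bij_ne_zero (fun k _ _ => k + Pi.single x 1) ?_ ?_ ?_ ?_
  · intro k hk _
    rw [mem_sector] at hk ⊢
    simp [Finset.sum_add_distrib, hk, Finset.sum_pi_single']
  · intro k _ _ k' _ _ h
    exact add_right_cancel h
  · intro n hn h0
    have hx : n x ≠ 0 := fun h => h0 (hφ n h)
    refine ⟨n - Pi.single x 1, ?_, ?_, single_add_tsub hx⟩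
    · rw [mem_sector] at hn ⊢
      have h1 : ∑ z, (n - Pi.single x 1 + Pi.single x 1 : ι → ℕ) z = N + 1 := by
        rw [single_add_tsub hx, hn]
      simpa [Finset.sum_add_distrib, Finset.sum_pi_single'] using h1
    · rwa [single_add_tsub hx]
  · intros; rfl

/-- For a Hermitian matrix `J` and a real weight `g`, the commutator form
`-2 Im ∑ J_{xy} g_x \bar A_x A_y` only sees the differences `g_x - g_y`. -/
theorem re_sum_hermitian_le [Fintype ι] {J : Matrix ι ι ℂ} (hJ : J.IsHermitian) (g : ι → ℝ)
    (A : ι → ℂ) :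
    2 * (∑ x, ∑ y, -Complex.I * (J x y * (g x * (starRingEnd ℂ (A x) * A y)))).re ≤
      ∑ x, ‖A x‖ ^ 2 * ∑ y, ‖J x y‖ * |g x - g y| := by
  set S : ℝ := (∑ x, ∑ y, -Complex.I * (J x y * (g x * (starRingEnd ℂ (A x) * A y)))).re
  set t : ι → ι → ℝ := fun x y => (-Complex.I * (J x y * (starRingEnd ℂ (A x) * A y))).re
  have hS : S = ∑ x, ∑ y, g x * t x y := by
    simp only [S, t, Complex.re_sum]
    refine Finset.sum_congr rfl fun x _ => Finset.sum_congr rfl fun y _ => ?_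
    rw [← Complex.re_ofReal_mul]; congr 1; ring
  have ht : ∀ x y, t y x = -t x y := by
    intro x y
    have h1 : J y x = starRingEnd ℂ (J x y) := (hJ.apply y x).symm
    have h2 : -Complex.I * (J y x * (starRingEnd ℂ (A y) * A x)) =
        -starRingEnd ℂ (-Complex.I * (J x y * (starRingEnd ℂ (A x) * A y))) := by
      rw [h1]; simp only [map_mul, map_neg, Complex.conj_I, Complex.conj_conj]; ring
    simp only [t]
    rw [h2, Complex.neg_re, Complex.conj_re]
  have hS' : S = -∑ x, ∑ y, g y * t x y := by
    rw [hS, Finset.sum_comm, ← Finset.sum_neg_distrib]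
    refine Finset.sum_congr rfl fun x _ => ?_
    rw [← Finset.sum_neg_distrib]
    refine Finset.sum_congr rfl fun y _ => ?_
    rw [ht]; ring
  have h2S : 2 * S = ∑ x, ∑ y, (g x - g y) * t x y := by
    simp only [sub_mul, Finset.sum_sub_distrib]
    rw [← hS]; linarith
  have hJn : ∀ x y, ‖J x y‖ = ‖J y x‖ := fun x y => by
    rw [← hJ.apply x y, norm_star]
  have hle : ∀ x y, (g x - g y) * t x y ≤
      (‖A x‖ ^ 2 * (‖J x y‖ * |g x - g y|)) / 2 + (‖A y‖ ^ 2 * (‖J y x‖ * |g y - g x|)) / 2 := by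
    intro x y
    have h1 : |t x y| ≤ ‖J x y‖ * (‖A x‖ * ‖A y‖) := by
      refine (Complex.abs_re_le_norm _).trans ?_
      simp
    have h2 : (g x - g y) * t x y ≤ |g x - g y| * (‖J x y‖ * (‖A x‖ * ‖A y‖)) := by
      refine (le_abs_self _).trans ?_
      rw [abs_mul]; gcongr
    rw [hJn y x, abs_sub_comm (g y)]
    have h3 : 0 ≤ |g x - g y| * ‖J x y‖ := by positivity
    nlinarith [mul_nonneg h3 (sq_nonneg (‖A x‖ - ‖A y‖))]
  rw [h2S]
  calc ∑ x, ∑ y, (g x - g y) * t x y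
      ≤ ∑ x, ∑ y, ((‖A x‖ ^ 2 * (‖J x y‖ * |g x - g y|)) / 2
          + (‖A y‖ ^ 2 * (‖J y x‖ * |g y - g x|)) / 2) :=
        Finset.sum_le_sum fun x _ => Finset.sum_le_sum fun y _ => hle x y
    _ = ∑ x, ∑ y, ‖A x‖ ^ 2 * (‖J x y‖ * |g x - g y|) := by
        simp only [Finset.sum_add_distrib]
        rw [Finset.sum_comm (f := fun x y => (‖A y‖ ^ 2 * (‖J y x‖ * |g y - g x|)) / 2)]
        simp only [← Finset.sum_add_distrib, add_halves]
    _ = _ := by simp only [Finset.mul_sum]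

/-- The quadratic form of `-i[H, G]` in a sector, for a function `G` of the occupation numbers, is
bounded by the classical jump process in which each particle at `x` jumps to `y` at the rate
`|J_{xy}|`. The interaction drops out. -/
theorem sum_sector_inner_hamiltonian_le [Fintype ι] [DecidableEq ι]
    {J : Matrix ι ι ℂ} (hJ : J.IsHermitian)
    (Φ : (ι → ℕ) → ℝ) (G : (ι → ℕ) → ℝ) (ψ : (ι → ℕ) → ℂ) (N : ℕ) :
    ∑ n ∈ sector ι N, G n * (2 * inner ℝ (ψ n) (-(Complex.I * hamiltonianAction J Φ ψ n))) ≤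
      ∑ n ∈ sector ι N, (∑ x, ∑ y, ‖J x y‖ * n x *
        |G n - G (n - Pi.single x 1 + Pi.single y 1)|) * ‖ψ n‖ ^ 2 := by
  have hterm : ∀ n, G n * (2 * inner ℝ (ψ n) (-(Complex.I * hamiltonianAction J Φ ψ n))) =
      2 * (∑ x, ∑ y, -Complex.I * (J x y * (G n * (starRingEnd ℂ (ψ n) *
        create x (annihilate y ψ) n)))).re := by
    intro n
    have h1 : (Complex.I * ((Φ n : ℂ) * ψ n) * starRingEnd ℂ (ψ n)).re = 0 := by
      have : Complex.I * ((Φ n : ℂ) * ψ n) * starRingEnd ℂ (ψ n) =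
          Complex.I * ((Φ n * Complex.normSq (ψ n) : ℝ) : ℂ) := by
        rw [mul_assoc, mul_assoc, Complex.mul_conj]; push_cast; ring
      rw [this, Complex.re_mul_ofReal]; simp
    have h2 : (∑ x, ∑ y, -Complex.I * (J x y * (G n * (starRingEnd ℂ (ψ n) *
        create x (annihilate y ψ) n)))) =
        ((G n : ℝ) : ℂ) * (-(Complex.I * (∑ x, ∑ y, J x y * create x (annihilate y ψ) n)) *
          starRingEnd ℂ (ψ n)) := by
      simp only [Finset.mul_sum, Finset.sum_mul, ← Finset.sum_neg_distrib]
      refine Finset.sum_congr rfl fun x _ => Finset.sum_congr rfl fun y _ => ?_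
      ring
    rw [h2, Complex.re_ofReal_mul, Complex.inner]
    simp only [hamiltonianAction, LinearMap.coe_mk, AddHom.coe_mk]
    rw [mul_add, neg_add, add_mul, Complex.add_re, neg_mul (Complex.I * ((Φ n : ℂ) * ψ n)),
      Complex.neg_re, h1]
    ring
  rw [Finset.sum_congr rfl fun n _ => hterm n, ← Finset.mul_sum, ← Complex.re_sum]
  rcases N with _ | N
  · have h0 : ∀ n ∈ sector ι 0, ∀ x, n x = 0 := fun n hn x =>
      Finset.sum_eq_zero_iff.mp (mem_sector.mp hn) x (Finset.mem_univ x)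
    have hl : ∑ n ∈ sector ι 0, ∑ x, ∑ y, -Complex.I * (J x y * (G n * (starRingEnd ℂ (ψ n) *
        create x (annihilate y ψ) n))) = 0 :=
      Finset.sum_eq_zero fun n hn => Finset.sum_eq_zero fun x _ => Finset.sum_eq_zero fun y _ => by
        rw [create_apply_of_eq_zero (h0 n hn x)]; simp
    rw [hl]
    simp only [Complex.zero_re, mul_zero]
    positivity
  · have hl : ∑ n ∈ sector ι (N + 1), ∑ x, ∑ y, -Complex.I * (J x y * (G n *
        (starRingEnd ℂ (ψ n) * create x (annihilate y ψ) n))) =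
        ∑ k ∈ sector ι N, ∑ x, ∑ y, -Complex.I * (J x y * (G (k + Pi.single x 1) *
          (starRingEnd ℂ (annihilate x ψ k) * annihilate y ψ k))) := by
      rw [Finset.sum_comm, Finset.sum_comm (s := sector ι N)]
      refine Finset.sum_congr rfl fun x _ => ?_
      rw [sum_sector_succ N x]
      · refine Finset.sum_congr rfl fun k _ => Finset.sum_congr rfl fun y _ => ?_
        rw [create_apply_add_single, annihilate_apply x, map_mul, Complex.conj_ofReal]
        ring
      · intro n hn
        exact Finset.sum_eq_zero fun y _ => by rw [create_apply_of_eq_zero hn]; simp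
    have hr : ∑ n ∈ sector ι (N + 1), (∑ x, ∑ y, ‖J x y‖ * n x *
        |G n - G (n - Pi.single x 1 + Pi.single y 1)|) * ‖ψ n‖ ^ 2 =
        ∑ k ∈ sector ι N, ∑ x, ‖annihilate x ψ k‖ ^ 2 *
          ∑ y, ‖J x y‖ * |G (k + Pi.single x 1) - G (k + Pi.single y 1)| := by
      simp only [Finset.sum_mul]
      rw [Finset.sum_comm, Finset.sum_comm (s := sector ι N)]
      refine Finset.sum_congr rfl fun x _ => ?_
      rw [sum_sector_succ N x]
      · refine Finset.sum_congr rfl fun k _ => ?_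
        rw [annihilate_apply, norm_mul, mul_pow, Complex.norm_real, Real.norm_eq_abs, sq_abs,
          Real.sq_sqrt (by positivity), Finset.mul_sum]
        refine Finset.sum_congr rfl fun y _ => ?_
        rw [add_tsub_cancel_right]
        simp only [Pi.add_apply, Pi.single_eq_same, Nat.cast_add, Nat.cast_one]
        ring
      · intro n hn
        exact Finset.sum_eq_zero fun y _ => by simp [hn]
    rw [hl, hr, Complex.re_sum, Finset.mul_sum]
    exact Finset.sum_le_sum fun k _ =>
      re_sum_hermitian_le hJ (fun x => G (k + Pi.single x 1)) fun x => annihilate x ψ k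

/-- Along a Schrödinger evolution, the expectation in a sector of a time-dependent function of the
occupation numbers does not increase if the function is a supersolution of the jump process with
rates `|J_{xy}|`. -/
theorem antitone_sum_sector [Fintype ι] [DecidableEq ι]
    {J : Matrix ι ι ℂ} (hJ : J.IsHermitian) {Φ : (ι → ℕ) → ℝ}
    {ψ : ℝ → FockSpace ι} (hψ : IsSchrodingerSolution (hamiltonian J Φ) ψ)
    {G G' : ℝ → (ι → ℕ) → ℝ} (hG : ∀ t n, HasDerivAt (fun s => G s n) (G' t n) t)
    (hsuper : ∀ t n, G' t n + ∑ x, ∑ y, ‖J x y‖ * n x *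
      |G t n - G t (n - Pi.single x 1 + Pi.single y 1)| ≤ 0) (N : ℕ) :
    Antitone fun t => ∑ n ∈ sector ι N, G t n * ‖ψ t n‖ ^ 2 := by
  have hder : ∀ t, HasDerivAt (fun t => ∑ n ∈ sector ι N, G t n * ‖ψ t n‖ ^ 2)
      (∑ n ∈ sector ι N, (G' t n * ‖ψ t n‖ ^ 2 +
        G t n * (2 * inner ℝ (ψ t n) (-(Complex.I * hamiltonianAction J Φ (ψ t) n))))) t := by
    intro t
    obtain ⟨ht, h⟩ := hψ t
    refine HasDerivAt.fun_sum fun n _ => (hG t n).mul (HasDerivAt.norm_sq ?_)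
    exact ((lp.evalCLM ℂ (fun _ : ι → ℕ => ℂ) 2 n).restrictScalars ℝ).hasFDerivAt.comp_hasDerivAt
      t h
  refine antitone_of_deriv_nonpos (fun t => (hder t).differentiableAt) fun t => ?_
  rw [(hder t).deriv, Finset.sum_add_distrib]
  have h1 := sum_sector_inner_hamiltonian_le hJ Φ (G t) (ψ t) N
  refine (add_le_add_right h1 _).trans ?_
  rw [← Finset.sum_add_distrib]
  refine Finset.sum_nonpos fun n _ => ?_
  rw [← add_mul]
  exact mul_nonpos_of_nonpos_of_nonneg (hsuper t n) (by positivity)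

/-- Inequalities between nonnegative expectations in every sector add up. -/
theorem tsum_le_tsum_of_sum_sector_le [Fintype ι] [DecidableEq ι] {f g : (ι → ℕ) → ℝ≥0∞}
    (h : ∀ N, ∑ n ∈ sector ι N, f n ≤ ∑ n ∈ sector ι N, g n) : ∑' n, f n ≤ ∑' n, g n := by
  have key : ∀ f : (ι → ℕ) → ℝ≥0∞, ∑' n, f n = ∑' N, ∑ n ∈ sector ι N, f n := by
    intro f
    rw [← ENNReal.tsum_fiberwise f fun n => ∑ x, n x]
    refine tsum_congr fun N => ?_
    have : (fun n : ι → ℕ => ∑ x, n x) ⁻¹' {N} = ↑(sector ι N) := by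
      ext n; simp [mem_sector]
    rw [this, Finset.tsum_subtype']
  rw [key, key]
  exact ENNReal.tsum_le_tsum h

end Dynamics

/-! ### The weighted particle number -/

theorem ofReal_sum_mul_norm_sq {ι : Type*} (s : Finset (ι → ℕ)) {g : (ι → ℕ) → ℝ}
    (hg : ∀ n, 0 ≤ g n)
    (ψ : FockSpace ι) :
    ENNReal.ofReal (∑ n ∈ s, g n * ‖ψ n‖ ^ 2) = ∑ n ∈ s, ENNReal.ofReal (g n) * ‖ψ n‖ₑ ^ 2 := by
  rw [ENNReal.ofReal_sum_of_nonneg fun n _ => mul_nonneg (hg n) (by positivity)]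
  refine Finset.sum_congr rfl fun n _ => ?_
  rw [ENNReal.ofReal_mul (hg n), ENNReal.ofReal_pow (norm_nonneg _), ofReal_norm]

section Weight

variable {ι : Type*} [Fintype ι]

/-- The weighted particle number `N_f = ∑_x f(x) n_x` of a configuration. -/
def weightedNumber (f : ι → ℝ) (n : ι → ℕ) : ℝ := ∑ x, n x * f x

theorem weightedNumber_nonneg {f : ι → ℝ} (hf : ∀ x, 0 ≤ f x) (n : ι → ℕ) :
    0 ≤ weightedNumber f n :=
  Finset.sum_nonneg fun x _ => mul_nonneg (Nat.cast_nonneg _) (hf x)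

theorem le_weightedNumber {f : ι → ℝ} (hf : ∀ x, 0 ≤ f x) {n : ι → ℕ} {x : ι} (hx : n x ≠ 0) :
    f x ≤ weightedNumber f n := by
  have h1 : (1 : ℝ) ≤ n x := by exact_mod_cast Nat.one_le_iff_ne_zero.mpr hx
  have h2 : n x * f x ≤ weightedNumber f n :=
    Finset.single_le_sum (f := fun x => (n x : ℝ) * f x)
      (fun x _ => mul_nonneg (Nat.cast_nonneg _) (hf x)) (Finset.mem_univ x)
  nlinarith [hf x]

theorem weightedNumber_add_single [DecidableEq ι] (f : ι → ℝ) (n : ι → ℕ) (x : ι) :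
    weightedNumber f (n + Pi.single x 1) = weightedNumber f n + f x := by
  simp [weightedNumber, add_mul, Finset.sum_add_distrib, Pi.single_apply]

theorem weightedNumber_hop [DecidableEq ι] (f : ι → ℝ) {n : ι → ℕ} {x : ι} (hx : n x ≠ 0) (y : ι) :
    weightedNumber f (n - Pi.single x 1 + Pi.single y 1) = weightedNumber f n + (f y - f x) := by
  have h := weightedNumber_add_single f (n - Pi.single x 1) x
  rw [single_add_tsub hx] at h
  rw [weightedNumber_add_single, h]; ring

theorem abs_pow_sub_add_pow_le {A F D : ℝ} (p : ℕ) (hF : 0 < F) (hA : F ≤ A) :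
    |A ^ p - (A + D) ^ p| ≤ p * A ^ (p - 1) * (|D| * (1 + |D| / F) ^ (p - 1)) := by
  have hA0 : 0 < A := hF.trans_le hA
  have h1 : max |A| |A + D| ≤ A * (1 + |D| / F) := by
    have h2 : |D| ≤ A * (|D| / F) := by
      rw [mul_div_assoc', le_div_iff₀ hF, mul_comm]
      exact mul_le_mul_of_nonneg_right hA (abs_nonneg D)
    have h3 : 0 ≤ A * (|D| / F) := (abs_nonneg D).trans h2
    refine max_le ?_ ((abs_add_le A D).trans ?_) <;> rw [abs_of_pos hA0] <;> linarith
  calc |A ^ p - (A + D) ^ p| ≤ |A - (A + D)| * p * max |A| |A + D| ^ (p - 1) :=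
        abs_pow_sub_pow_le A (A + D) p
    _ ≤ |D| * p * (A * (1 + |D| / F)) ^ (p - 1) := by
        rw [show A - (A + D) = -D by ring, abs_neg]
        gcongr
    _ = _ := by rw [mul_pow]; ring

/-- The `p`-th power of the particle number weighted by a receding step profile is a supersolution
of the jump process, once the profile moves at a speed `v` that beats the jump rates, measured on
the scale `L` of the profile. -/
theorem weightedNumber_supersolution [DecidableEq ι] {J : Matrix ι ι ℂ} {b θ C v L : ℝ} {p : ℕ}
    (hb : 1 ≤ b) (hθ : 0 ≤ θ) (hC : 0 ≤ C)
    (hprof : ∀ a c : ℝ,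
      |profile b a - profile b c| * (1 + |profile b a - profile b c| / profile b a) ^ (p - 1) ≤
        profileSlope b a * (θ * |a - c| + C * |a - c| ^ (p * b + 1)))
    {D : ι → ι → ℝ} {a : ι → ℝ} (haD : ∀ x y, |a x - a y| ≤ D x y / L)
    (hJ : ∀ x, ∑ y, ‖J x y‖ * (θ * (D x y / L) + C * (D x y / L) ^ (p * b + 1)) ≤ v / L)
    (n : ι → ℕ) :
    p * weightedNumber (fun x => profile b (a x)) n ^ (p - 1) *
        weightedNumber (fun x => -profileSlope b (a x) * (v / L)) n +
      ∑ x, ∑ y, ‖J x y‖ * n x * |weightedNumber (fun x => profile b (a x)) n ^ p -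
        weightedNumber (fun x => profile b (a x)) (n - Pi.single x 1 + Pi.single y 1) ^ p| ≤ 0 := by
  set f : ι → ℝ := fun x => profile b (a x)
  have hf : ∀ x, 0 ≤ f x := fun x => (profile_pos hb _).le
  set A := weightedNumber f n
  have hA : 0 ≤ A := weightedNumber_nonneg hf n
  have hpb : 0 ≤ p * b + 1 := by positivity
  have hterm : ∀ x, ∑ y, ‖J x y‖ * n x *
      |A ^ p - weightedNumber f (n - Pi.single x 1 + Pi.single y 1) ^ p| ≤
      p * A ^ (p - 1) * (n x * (profileSlope b (a x) * (v / L))) := by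
    intro x
    have hw := (profileSlope_pos hb (a x)).le
    calc ∑ y, ‖J x y‖ * n x * |A ^ p - weightedNumber f (n - Pi.single x 1 + Pi.single y 1) ^ p|
        ≤ ∑ y, ‖J x y‖ * n x * (p * A ^ (p - 1) * (profileSlope b (a x) *
            (θ * (D x y / L) + C * (D x y / L) ^ (p * b + 1)))) := by
          refine Finset.sum_le_sum fun y _ => ?_
          by_cases hx : n x = 0
          · simp [hx]
          refine mul_le_mul_of_nonneg_left ?_ (by positivity)
          rw [weightedNumber_hop f hx y]
          refine (abs_pow_sub_add_pow_le p (profile_pos hb (a x))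
            (le_weightedNumber hf hx)).trans ?_
          refine mul_le_mul_of_nonneg_left ?_ (by positivity)
          rw [abs_sub_comm (f y) (f x)]
          refine (hprof (a x) (a y)).trans ?_
          have h1 := haD x y
          gcongr
      _ = p * A ^ (p - 1) * (n x * (profileSlope b (a x) * ∑ y, ‖J x y‖ *
            (θ * (D x y / L) + C * (D x y / L) ^ (p * b + 1)))) := by
          simp only [Finset.mul_sum]
          exact Finset.sum_congr rfl fun y _ => by ring
      _ ≤ _ := by gcongr; exact hJ x
  refine (add_le_add_right (Finset.sum_le_sum fun x _ => hterm x) _).trans ?_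
  rw [← Finset.mul_sum, ← mul_add, weightedNumber, ← Finset.sum_add_distrib]
  refine (mul_eq_zero_of_right _ (Finset.sum_eq_zero fun x _ => by ring)).le

/-- The moment of the particle number weighted by the receding step profile at a later time is
bounded by the one at the initial time. -/
theorem tsum_weightedNumber_le [DecidableEq ι] {J : Matrix ι ι ℂ} (hJH : J.IsHermitian)
    {Φ : (ι → ℕ) → ℝ} {ψ : ℝ → FockSpace ι} (hψ : IsSchrodingerSolution (hamiltonian J Φ) ψ)
    {b θ C v L u₀ : ℝ} {p : ℕ} (hb : 1 ≤ b) (hL : 0 < L) (hθ : 0 ≤ θ) (hC : 0 ≤ C)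
    (hprof : ∀ a c : ℝ,
      |profile b a - profile b c| * (1 + |profile b a - profile b c| / profile b a) ^ (p - 1) ≤
        profileSlope b a * (θ * |a - c| + C * |a - c| ^ (p * b + 1)))
    {D : ι → ι → ℝ} {a : ι → ℝ} (haD : ∀ x y, |a x - a y| ≤ D x y)
    (hJ : ∀ x, ∑ y, ‖J x y‖ * (θ * (D x y / L) + C * (D x y / L) ^ (p * b + 1)) ≤ v / L)
    {t : ℝ} (ht : 0 ≤ t) :
    ∑' n, ENNReal.ofReal
        (weightedNumber (fun x => profile b ((a x + v * t - u₀) / L)) n ^ p) * ‖ψ t n‖ₑ ^ 2 ≤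
      ∑' n, ENNReal.ofReal
        (weightedNumber (fun x => profile b ((a x - u₀) / L)) n ^ p) * ‖ψ 0 n‖ₑ ^ 2 := by
  have hnn : ∀ s n, 0 ≤ weightedNumber (fun x => profile b ((a x + v * s - u₀) / L)) n ^ p :=
    fun s n => pow_nonneg (weightedNumber_nonneg (fun x => (profile_pos hb _).le) n) p
  refine tsum_le_tsum_of_sum_sector_le fun N => ?_
  have hG : ∀ s n, HasDerivAt
      (fun s => weightedNumber (fun x => profile b ((a x + v * s - u₀) / L)) n ^ p)
      (p * weightedNumber (fun x => profile b ((a x + v * s - u₀) / L)) n ^ (p - 1) *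
        weightedNumber (fun x => -profileSlope b ((a x + v * s - u₀) / L) * (v / L)) n) s := by
    intro s n
    refine HasDerivAt.fun_pow (HasDerivAt.fun_sum fun x _ => ?_) p
    refine HasDerivAt.const_mul _ ?_
    refine HasDerivAt.comp (h₂ := profile b) (h := fun s => (a x + v * s - u₀) / L) s
      (hasDerivAt_profile b _) ?_
    have := ((((hasDerivAt_id s).const_mul v).const_add (a x)).sub_const u₀).div_const L
    simpa using this
  have h := antitone_sum_sector hJH hψ hG (fun s n =>
    weightedNumber_supersolution hb hθ hC hprof (fun x y => by
      rw [← sub_div, abs_div, abs_of_pos hL]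
      gcongr
      refine le_trans (le_of_eq ?_) (haD x y)
      congr 1; ring) hJ n) N ht
  have h0 := ENNReal.ofReal_le_ofReal h
  rw [ofReal_sum_mul_norm_sq _ (hnn t), ofReal_sum_mul_norm_sq _ (hnn 0)] at h0
  simpa using h0

theorem ofReal_mul_numberMoment_le {f : ι → ℝ} {c : ℝ} (hc : 0 ≤ c) (hf : ∀ x, 0 ≤ f x)
    {X : Finset ι} (hX : ∀ x ∈ X, c ≤ f x) (p : ℕ) (ψ : FockSpace ι) :
    ENNReal.ofReal (c ^ p) * numberMoment X p ψ ≤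
      ∑' n, ENNReal.ofReal (weightedNumber f n ^ p) * ‖ψ n‖ₑ ^ 2 := by
  rw [numberMoment, ← ENNReal.tsum_mul_left]
  refine ENNReal.tsum_le_tsum fun n => ?_
  rw [← mul_assoc, ← ENNReal.ofReal_natCast, ← ENNReal.ofReal_pow (Nat.cast_nonneg _),
    ← ENNReal.ofReal_mul (by positivity), ← mul_pow]
  gcongr
  calc c * ((∑ x ∈ X, n x : ℕ) : ℝ) = ∑ x ∈ X, n x * c := by
        rw [Nat.cast_sum, Finset.mul_sum]; exact Finset.sum_congr rfl fun x _ => mul_comm _ _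
    _ ≤ ∑ x ∈ X, n x * f x :=
        Finset.sum_le_sum fun x hx => mul_le_mul_of_nonneg_left (hX x hx) (Nat.cast_nonneg _)
    _ ≤ weightedNumber f n :=
        Finset.sum_le_sum_of_subset_of_nonneg (Finset.subset_univ X)
          fun x _ _ => mul_nonneg (Nat.cast_nonneg _) (hf x)

theorem add_pow_le_weighted {A B σ : ℝ} (hA : 0 ≤ A) (hB : 0 ≤ B) (hσ : 0 < σ) {p : ℕ}
    (hp : 1 ≤ p) :
    (A + B) ^ p ≤ (1 + σ) ^ (p - 1) * A ^ p + (1 + σ⁻¹) ^ (p - 1) * B ^ p := by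
  obtain ⟨q, rfl⟩ : ∃ q, p = q + 1 := ⟨p - 1, by omega⟩
  have h : ((1 + σ)⁻¹ • ((1 + σ) * A) + (1 + σ⁻¹)⁻¹ • ((1 + σ⁻¹) * B)) ^ (q + 1) ≤
      (1 + σ)⁻¹ • ((1 + σ) * A) ^ (q + 1) + (1 + σ⁻¹)⁻¹ • ((1 + σ⁻¹) * B) ^ (q + 1) :=
    (convexOn_pow (𝕜 := ℝ) (q + 1)).2 (Set.mem_Ici.mpr (by positivity))
      (Set.mem_Ici.mpr (by positivity)) (by positivity) (by positivity) (by field_simp; ring)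
  simp only [smul_eq_mul] at h
  rw [inv_mul_cancel_left₀ (by positivity), inv_mul_cancel_left₀ (by positivity), mul_pow,
    mul_pow] at h
  refine h.trans (le_of_eq ?_)
  rw [Nat.add_sub_cancel, pow_succ (1 + σ), pow_succ (1 + σ⁻¹)]
  field_simp

theorem sum_mul_pow_le {κ : Type*} {s : Finset κ} {f z : κ → ℝ} (hf : ∀ x ∈ s, 0 ≤ f x)
    (hz : ∀ x ∈ s, 0 ≤ z x) {p : ℕ} (hp : 1 ≤ p) :
    (∑ x ∈ s, f x * z x) ^ p ≤ (∑ x ∈ s, f x) ^ (p - 1) * ∑ x ∈ s, f x * z x ^ p := by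
  rcases (Finset.sum_nonneg hf).eq_or_lt with h0 | h0
  · have h1 := (Finset.sum_eq_zero_iff_of_nonneg hf).mp h0.symm
    rw [Finset.sum_eq_zero fun x hx => by rw [h1 x hx, zero_mul], zero_pow (by omega)]
    exact mul_nonneg (by rw [← h0]; positivity) (Finset.sum_nonneg fun x hx =>
      mul_nonneg (hf x hx) (pow_nonneg (hz x hx) p))
  · set W := ∑ x ∈ s, f x
    have h := Real.pow_arith_mean_le_arith_mean_pow s (fun x => f x / W) z
      (fun x hx => div_nonneg (hf x hx) h0.le) (by rw [← Finset.sum_div, div_self h0.ne']) hz p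
    simp only [div_mul_eq_mul_div, ← Finset.sum_div, div_pow] at h
    obtain ⟨q, rfl⟩ : ∃ q, p = q + 1 := ⟨p - 1, by omega⟩
    rw [div_le_div_iff₀ (by positivity) h0, pow_succ W, ← mul_assoc] at h
    rw [Nat.add_sub_cancel, mul_comm (W ^ q)]
    exact le_of_mul_le_mul_right h h0

/-- The weighted moment of a state whose on-site moments are bounded: the sites in `X` contribute
the moment of `N_X`, the others only the on-site bound times a power of their total weight. The
constant in front of the moment of `N_X` is close to `m^p` for small `σ`. -/
theorem tsum_weightedNumber_le_add {f : ι → ℝ} (hf : ∀ x, 0 ≤ f x) {X : Finset ι} {m T μ σ : ℝ}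
    (hm : 0 ≤ m) (hσ : 0 < σ) (hμ : 0 ≤ μ) (hX : ∀ x ∈ X, f x ≤ m) [DecidableEq ι]
    (hT : ∑ x ∈ Xᶜ, f x ≤ T) {p : ℕ} (hp : 1 ≤ p) {ψ : FockSpace ι}
    (hψ : ∀ x, numberMoment {x} p ψ ≤ ENNReal.ofReal μ) :
    ∑' n, ENNReal.ofReal (weightedNumber f n ^ p) * ‖ψ n‖ₑ ^ 2 ≤
      ENNReal.ofReal ((1 + σ) ^ (p - 1) * m ^ p) * numberMoment X p ψ +
        ENNReal.ofReal ((1 + σ⁻¹) ^ (p - 1) * T ^ p * μ) := by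
  have hW : 0 ≤ ∑ x ∈ Xᶜ, f x := Finset.sum_nonneg fun x _ => hf x
  have hT0 : 0 ≤ T := hW.trans hT
  have hpt : ∀ n : ι → ℕ, weightedNumber f n ^ p ≤
      (1 + σ) ^ (p - 1) * m ^ p * ((∑ x ∈ X, n x : ℕ) : ℝ) ^ p +
        (1 + σ⁻¹) ^ (p - 1) * T ^ (p - 1) * ∑ x ∈ Xᶜ, f x * (n x : ℝ) ^ p := by
    intro n
    have h1 : weightedNumber f n ≤ m * ((∑ x ∈ X, n x : ℕ) : ℝ) + ∑ x ∈ Xᶜ, f x * n x := by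
      rw [weightedNumber, ← Finset.sum_add_sum_compl X, Nat.cast_sum, Finset.mul_sum]
      refine add_le_add (Finset.sum_le_sum fun x hx => ?_)
        (Finset.sum_le_sum fun x _ => (mul_comm _ _).le)
      rw [mul_comm]
      exact mul_le_mul_of_nonneg_right (hX x hx) (Nat.cast_nonneg _)
    have hB : 0 ≤ ∑ x ∈ Xᶜ, f x * n x :=
      Finset.sum_nonneg fun x _ => mul_nonneg (hf x) (Nat.cast_nonneg _)
    refine (pow_le_pow_left₀ (weightedNumber_nonneg hf n) h1 p).trans ?_
    refine (add_pow_le_weighted (by positivity) hB hσ hp).trans ?_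
    rw [mul_pow, ← mul_assoc, mul_assoc ((1 + σ⁻¹) ^ (p - 1))]
    have h2 := sum_mul_pow_le (s := Xᶜ) (z := fun x => (n x : ℝ)) (fun x _ => hf x)
      (fun x _ => Nat.cast_nonneg _) hp
    have h3 : 0 ≤ ∑ x ∈ Xᶜ, f x * (n x : ℝ) ^ p :=
      Finset.sum_nonneg fun x _ => mul_nonneg (hf x) (by positivity)
    have h4 : (∑ x ∈ Xᶜ, f x * (n x : ℝ)) ^ p ≤ T ^ (p - 1) * ∑ x ∈ Xᶜ, f x * (n x : ℝ) ^ p :=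
      h2.trans (by gcongr)
    gcongr
  have hpt' : ∀ n : ι → ℕ, ENNReal.ofReal (weightedNumber f n ^ p) * ‖ψ n‖ₑ ^ 2 ≤
      ENNReal.ofReal ((1 + σ) ^ (p - 1) * m ^ p) *
          (((∑ x ∈ X, n x : ℕ) : ℝ≥0∞) ^ p * ‖ψ n‖ₑ ^ 2) +
        ENNReal.ofReal ((1 + σ⁻¹) ^ (p - 1) * T ^ (p - 1)) *
          ∑ x ∈ Xᶜ, ENNReal.ofReal (f x) *
            (((∑ z ∈ {x}, n z : ℕ) : ℝ≥0∞) ^ p * ‖ψ n‖ₑ ^ 2) := by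
    intro n
    have h0 : ∀ x ∈ Xᶜ, 0 ≤ f x * (n x : ℝ) ^ p := fun x _ => mul_nonneg (hf x) (by positivity)
    refine (mul_le_mul_left (ENNReal.ofReal_le_ofReal (hpt n)) _).trans (le_of_eq ?_)
    rw [ENNReal.ofReal_add (by positivity) (mul_nonneg (by positivity) (Finset.sum_nonneg h0)),
      ENNReal.ofReal_mul (p := (1 + σ) ^ (p - 1) * m ^ p) (by positivity),
      ENNReal.ofReal_mul (p := (1 + σ⁻¹) ^ (p - 1) * T ^ (p - 1)) (by positivity),
      ENNReal.ofReal_sum_of_nonneg h0, add_mul, ENNReal.ofReal_pow (Nat.cast_nonneg _),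
      ENNReal.ofReal_natCast, mul_assoc, mul_assoc, Finset.sum_mul]
    congr 2
    refine Finset.sum_congr rfl fun x _ => ?_
    rw [ENNReal.ofReal_mul (hf x), ENNReal.ofReal_pow (Nat.cast_nonneg _), ENNReal.ofReal_natCast,
      mul_assoc, Finset.sum_singleton]
  refine (ENNReal.tsum_le_tsum hpt').trans ?_
  rw [ENNReal.tsum_add, ENNReal.tsum_mul_left, ENNReal.tsum_mul_left]
  refine add_le_add le_rfl ?_
  rw [Summable.tsum_finsetSum fun x _ => ENNReal.summable]
  have h5 : ∀ x ∈ Xᶜ, ∑' n : ι → ℕ, ENNReal.ofReal (f x) *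
      (((∑ z ∈ {x}, n z : ℕ) : ℝ≥0∞) ^ p * ‖ψ n‖ₑ ^ 2) ≤ ENNReal.ofReal (f x * μ) := by
    intro x _
    rw [ENNReal.tsum_mul_left, ENNReal.ofReal_mul (hf x)]
    gcongr
    exact hψ x
  calc ENNReal.ofReal ((1 + σ⁻¹) ^ (p - 1) * T ^ (p - 1)) * _
      ≤ ENNReal.ofReal ((1 + σ⁻¹) ^ (p - 1) * T ^ (p - 1)) *
          ∑ x ∈ Xᶜ, ENNReal.ofReal (f x * μ) := by gcongr with x hx; exact h5 x hx
    _ = ENNReal.ofReal ((1 + σ⁻¹) ^ (p - 1) * T ^ (p - 1) * ((∑ x ∈ Xᶜ, f x) * μ)) := by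
        rw [← ENNReal.ofReal_sum_of_nonneg fun x _ => mul_nonneg (hf x) hμ,
          ← ENNReal.ofReal_mul (by positivity), Finset.sum_mul]
    _ ≤ _ := by
        refine ENNReal.ofReal_le_ofReal ?_
        obtain ⟨q, rfl⟩ : ∃ q, p = q + 1 := ⟨p - 1, by omega⟩
        rw [Nat.add_sub_cancel, pow_succ T, mul_assoc, mul_assoc, mul_assoc]
        gcongr

end Weight

/-! ### Long-range hopping on separated sets -/

theorem hoppingSpeed_nonneg {d : ℕ} (Λ : Finset (EuclideanSpace ℝ (Fin d))) (J : Matrix Λ Λ ℂ) :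
    0 ≤ hoppingSpeed Λ J :=
  Real.iSup_nonneg fun x => Finset.sum_nonneg fun y _ => by positivity

/-- For `L` large, the moments of the hopping matrix that a step profile of scale `L` feels stay
below any prescribed speed `v` above `κ`, uniformly in the lattice. -/
theorem exists_scale (d : ℕ) {α C_J κ v C k : ℝ} (hC_J : 0 < C_J) (hκ : 0 ≤ κ) (hv : κ < v)
    (hC : 0 < C) (hk : 2 ≤ k) (hkα : k + d < α) :
    ∃ L : ℝ, 1 ≤ L ∧ ∀ Λ : Finset (EuclideanSpace ℝ (Fin d)),
      (∀ x ∈ Λ, ∀ y ∈ Λ, x ≠ y → 1 ≤ dist x y) → ∀ J : Matrix Λ Λ ℂ,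
      (∀ x y : Λ, x ≠ y → ‖J x y‖ ≤ C_J * dist x y ^ (-α)) → hoppingSpeed Λ J ≤ κ →
      ∀ x : Λ, ∑ y : Λ, ‖J x y‖ *
        ((1 + (v - κ) / (2 * (κ + 1))) * (dist x y / L) + C * (dist x y / L) ^ k) ≤ v / L := by
  classical
  obtain ⟨S, hS, hsum⟩ := exists_sum_dist_rpow_le d (β := α - k) (by linarith)
  have hvκ : 0 < v - κ := by linarith
  set L : ℝ := max 1 (2 * (C * (C_J * S)) / (v - κ))
  have hL1 : 1 ≤ L := le_max_left _ _
  have hL0 : 0 < L := by linarith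
  refine ⟨L, hL1, fun Λ hΛ J hJ hspeed x => ?_⟩
  have hfirst : ∑ y : Λ, ‖J x y‖ * dist x y ≤ κ :=
    (le_ciSup (f := fun x : Λ => ∑ y : Λ, ‖J x y‖ * dist x y) (Set.finite_range _).bddAbove x).trans
      hspeed
  have hpow : ∑ y : Λ, ‖J x y‖ * dist x y ^ k ≤ C_J * S := by
    have h1 : ∀ y : Λ, ‖J x y‖ * dist x y ^ k ≤
        if (y : EuclideanSpace ℝ (Fin d)) ∈ Λ.erase (x : EuclideanSpace ℝ (Fin d)) then
          C_J * dist (y : EuclideanSpace ℝ (Fin d)) x ^ (-(α - k)) else 0 := by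
      intro y
      by_cases hxy : x = y
      · subst hxy; simp [Real.zero_rpow (by linarith : k ≠ 0)]
      · have hne : (y : EuclideanSpace ℝ (Fin d)) ≠ x := fun h => hxy (Subtype.ext h.symm)
        have hd : 0 < dist x y := dist_pos.mpr hxy
        rw [if_pos (Finset.mem_erase.mpr ⟨hne, y.2⟩), dist_comm (y : EuclideanSpace ℝ (Fin d)),
          ← Subtype.dist_eq, neg_sub, sub_eq_neg_add, Real.rpow_add hd, ← mul_assoc]
        exact mul_le_mul_of_nonneg_right (hJ x y hxy) (by positivity)
    refine (Finset.sum_le_sum fun y _ => h1 y).trans ?_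
    rw [Finset.sum_coe_sort Λ fun y => if y ∈ Λ.erase (x : EuclideanSpace ℝ (Fin d)) then
      C_J * dist y x ^ (-(α - k)) else 0, ← Finset.sum_filter, Finset.filter_mem_eq_inter,
      Finset.inter_eq_right.mpr (Finset.erase_subset _ _), ← Finset.mul_sum]
    refine mul_le_mul_of_nonneg_left (hsum _ ?_ x ?_) hC_J.le
    · exact fun a ha b hb => hΛ a (Finset.mem_of_mem_erase ha) b (Finset.mem_of_mem_erase hb)
    · exact fun a ha => hΛ a (Finset.mem_of_mem_erase ha) x x.2 (Finset.ne_of_mem_erase ha)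
  set θ : ℝ := 1 + (v - κ) / (2 * (κ + 1))
  have hθ : θ * κ ≤ κ + (v - κ) / 2 := by
    have h1 : (v - κ) / (2 * (κ + 1)) * κ ≤ (v - κ) / 2 := by
      rw [div_mul_eq_mul_div, div_le_div_iff₀ (by positivity) two_pos]
      nlinarith
    simp only [θ]; linarith
  have hLk : L⁻¹ ^ k ≤ L⁻¹ * L⁻¹ := by
    have h2 : L⁻¹ ^ k ≤ L⁻¹ ^ (2 : ℝ) :=
      Real.rpow_le_rpow_of_exponent_ge (by positivity) (inv_le_one_of_one_le₀ hL1) hk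
    rwa [Real.rpow_two, sq] at h2
  have hCL : C * (C_J * S) * L⁻¹ ≤ (v - κ) / 2 := by
    have h3 : 2 * (C * (C_J * S)) / (v - κ) ≤ L := le_max_right _ _
    rw [div_le_iff₀ hvκ] at h3
    rw [mul_inv_le_iff₀ hL0]
    linarith
  have hθ0 : 0 ≤ θ := by positivity
  calc ∑ y : Λ, ‖J x y‖ * (θ * (dist x y / L) + C * (dist x y / L) ^ k)
      = θ * L⁻¹ * ∑ y : Λ, ‖J x y‖ * dist x y + C * L⁻¹ ^ k * ∑ y : Λ, ‖J x y‖ * dist x y ^ k := by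
        rw [Finset.mul_sum, Finset.mul_sum, ← Finset.sum_add_distrib]
        refine Finset.sum_congr rfl fun y _ => ?_
        rw [div_eq_mul_inv, Real.mul_rpow dist_nonneg (by positivity)]
        ring
    _ ≤ θ * L⁻¹ * κ + C * (L⁻¹ * L⁻¹) * (C_J * S) := by gcongr
    _ = (θ * κ + C * (C_J * S) * L⁻¹) * L⁻¹ := by ring
    _ ≤ v * L⁻¹ := mul_le_mul_of_nonneg_right (by linarith) (by positivity)
    _ = v / L := (div_eq_mul_inv _ _).symm

/-- Exponent arithmetic: there is a tail exponent `b` of the profile that makes the weight outside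
a ball summable with room to spare, while the moment of order `p b + 1` of the hopping is finite. -/
theorem exists_exponent {d p : ℕ} (hd : 1 ≤ d) (hp : 1 ≤ p) {α : ℝ}
    (hα : 2 * (d : ℝ) * (p : ℝ) + 1 < α) :
    ∃ b : ℝ, 1 ≤ b ∧ (d : ℝ) < b - (p - 1) / p ∧ p * b + 1 + d < α := by
  have hd' : (1 : ℝ) ≤ d := by exact_mod_cast hd
  have hp' : (1 : ℝ) ≤ p := by exact_mod_cast hp
  have hp0 : (0 : ℝ) < p := by linarith
  have hq : 0 ≤ ((p : ℝ) - 1) / p := div_nonneg (by linarith) hp0.le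
  have hlu : (d : ℝ) + (p - 1) / p < (α - 1 - d) / p := by
    rw [lt_div_iff₀ hp0, add_mul, div_mul_cancel₀ _ hp0.ne']
    nlinarith [mul_nonneg (sub_nonneg.mpr hd') (sub_nonneg.mpr hp')]
  obtain ⟨b, hb1, hb2⟩ := exists_between hlu
  refine ⟨b, by linarith, by linarith, ?_⟩
  rw [lt_div_iff₀ hp0] at hb2
  linarith

theorem one_add_mul_pow_le {K y : ℝ} (hK : 0 ≤ K) (hy0 : 0 ≤ y) (hy1 : y ≤ 1) (m : ℕ) :
    (1 + K * y) ^ m ≤ 1 + (1 + K) ^ m * y := by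
  have h : ((1 - y) • (1 : ℝ) + y • (1 + K)) ^ m ≤ (1 - y) • (1 : ℝ) ^ m + y • (1 + K) ^ m :=
    (convexOn_pow (𝕜 := ℝ) m).2 (Set.mem_Ici.mpr zero_le_one) (Set.mem_Ici.mpr (by positivity))
      (by linarith) hy0 (by ring)
  simp only [smul_eq_mul, one_pow, mul_one] at h
  rw [show 1 - y + y * (1 + K) = 1 + K * y by ring] at h
  linarith

theorem two_div_profile_neg_le {b q : ℝ} (hb : 1 ≤ b) (hq : 0 < q) :
    2 / profile b (-q) ≤ 1 + q⁻¹ := by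
  have hz : (1 + q) ^ (-b) ≤ q⁻¹ := by
    calc (1 + q) ^ (-b) ≤ (1 + q) ^ (-1 : ℝ) :=
          Real.rpow_le_rpow_of_exponent_le (by linarith) (by linarith)
      _ ≤ q⁻¹ := by
          rw [Real.rpow_neg_one]
          exact inv_anti₀ hq (by linarith)
  have hz1 : (1 + q) ^ (-b) ≤ 1 := Real.rpow_le_one_of_one_le_of_nonpos (by linarith) (by linarith)
  have hz0 : 0 ≤ (1 + q) ^ (-b) := by positivity
  rw [profile, if_neg (by linarith), sub_neg_eq_add]
  set z := (1 + q) ^ (-b)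
  refine le_trans ?_ (add_le_add_right hz 1)
  rw [div_le_iff₀ (by linarith)]
  nlinarith

/-- The total weight of a step profile outside a ball whose radius exceeds the step by a multiple
of itself. -/
theorem exists_sum_profile_le (d : ℕ) {b e c L : ℝ} (hb : 1 ≤ b) (he : 0 ≤ e)
    (hbe : (d : ℝ) < b - e) (hc : 0 < c) (hL : 0 < L) :
    ∃ K : ℝ, 0 < K ∧ ∀ Λ : Finset (EuclideanSpace ℝ (Fin d)),
      (∀ x ∈ Λ, ∀ y ∈ Λ, x ≠ y → 1 ≤ dist x y) → ∀ (X : Finset Λ) (s u₀ : ℝ), 1 ≤ s →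
      (∀ x ∈ X, s ≤ ‖(x : EuclideanSpace ℝ (Fin d))‖) →
      (∀ x ∈ X, c * ‖(x : EuclideanSpace ℝ (Fin d))‖ ≤ ‖(x : EuclideanSpace ℝ (Fin d))‖ - u₀) →
      ∑ x ∈ X, profile b ((‖(x : EuclideanSpace ℝ (Fin d))‖ - u₀) / L) ≤ K * s ^ (-e) := by
  obtain ⟨S, hS, hsum⟩ := exists_sum_dist_rpow_le d hbe
  refine ⟨(c / L) ^ (-b) * S, by positivity, fun Λ hΛ X s u₀ hs hX hXc => ?_⟩
  have hpt : ∀ x ∈ X, profile b ((‖(x : EuclideanSpace ℝ (Fin d))‖ - u₀) / L) ≤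
      (c / L) ^ (-b) * s ^ (-e) * dist (x : EuclideanSpace ℝ (Fin d)) 0 ^ (-(b - e)) := by
    intro x hx
    rw [dist_zero_right]
    have h1 := hX x hx
    have h2 := hXc x hx
    set ρ := ‖(x : EuclideanSpace ℝ (Fin d))‖
    have hρ : 0 < ρ := by linarith
    have h3 : c / L * ρ ≤ (ρ - u₀) / L := by
      rw [div_mul_eq_mul_div]; gcongr
    have h4 : 0 < c / L * ρ := by positivity
    rw [profile, if_pos (h4.le.trans h3)]
    calc (1 + (ρ - u₀) / L) ^ (-b) ≤ (c / L * ρ) ^ (-b) :=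
          Real.rpow_le_rpow_of_nonpos h4 (by linarith) (by linarith)
      _ = (c / L) ^ (-b) * ρ ^ (-e) * ρ ^ (-(b - e)) := by
          rw [Real.mul_rpow (by positivity) hρ.le, mul_assoc, ← Real.rpow_add hρ]
          congr 2; ring
      _ ≤ (c / L) ^ (-b) * s ^ (-e) * ρ ^ (-(b - e)) := by
          have h5 : ρ ^ (-e) ≤ s ^ (-e) :=
            Real.rpow_le_rpow_of_nonpos (by linarith) h1 (by linarith)
          gcongr
  refine (Finset.sum_le_sum hpt).trans ?_
  rw [← Finset.mul_sum]
  have h6 : ∑ x ∈ X, dist (x : EuclideanSpace ℝ (Fin d)) 0 ^ (-(b - e)) ≤ S := by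
    have h7 := hsum (X.map (Function.Embedding.subtype _)) ?_ 0 ?_
    · simpa using h7
    · intro x hx y hy
      simp only [Finset.mem_map, Function.Embedding.coe_subtype] at hx hy
      obtain ⟨x, -, rfl⟩ := hx
      obtain ⟨y, -, rfl⟩ := hy
      exact hΛ x x.2 y y.2
    · intro x hx
      simp only [Finset.mem_map, Function.Embedding.coe_subtype] at hx
      obtain ⟨x, hx, rfl⟩ := hx
      rw [dist_zero_right]
      exact hs.trans (hX x hx)
  calc (c / L) ^ (-b) * s ^ (-e) * ∑ x ∈ X, dist (x : EuclideanSpace ℝ (Fin d)) 0 ^ (-(b - e))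
      ≤ (c / L) ^ (-b) * s ^ (-e) * S := by gcongr
    _ = _ := by ring

end LatticeBosons
end

/-! ### The propagation bound -/

theorem theorem2p1 (d p : ℕ) (hd : 1 ≤ d) (hp : 1 ≤ p)
    (α C_J : ℝ) (hα : 2 * (d : ℝ) * (p : ℝ) + 1 < α) (hC_J : 0 < C_J)
    (κ v δ₀ : ℝ) (hv : κ < v) (hδ₀ : 0 < δ₀) :
    ∃ C : ℝ, 0 < C ∧
      ∀ Λ : Finset (EuclideanSpace ℝ (Fin d)),
        (∀ x ∈ Λ, ∀ y ∈ Λ, x ≠ y → 1 ≤ dist x y) →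
      ∀ J : Matrix Λ Λ ℂ, J.IsHermitian →
        (∀ x y : Λ, x ≠ y → ‖J x y‖ ≤ C_J * dist x y ^ (-α)) →
        LatticeBosons.hoppingSpeed Λ J ≤ κ →
      ∀ Φ : (Λ → ℕ) → ℝ,
      ∀ lam R r : ℝ, 0 < lam → 0 < R → 0 < r → max (δ₀ * r) 1 < R - r →
      ∀ ψ₀ : LatticeBosons.FockSpace Λ, ‖ψ₀‖ = 1 →
        (∀ X : Finset Λ,
          LatticeBosons.numberMoment X p ψ₀ ≤ ENNReal.ofReal ((lam * (X.card : ℝ)) ^ p)) →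
      ∀ ψ : ℝ → LatticeBosons.FockSpace Λ,
        LatticeBosons.IsSchrodingerSolution (LatticeBosons.hamiltonian J Φ) ψ → ψ 0 = ψ₀ →
        ⨆ t ∈ Set.Ico (0 : ℝ) ((R - r) / v),
            LatticeBosons.numberMoment (LatticeBosons.latticeBall Λ r) p (ψ t)
          ≤ LatticeBosons.numberMoment (LatticeBosons.latticeBall Λ R) p ψ₀
            + ENNReal.ofReal (C * (R - r)⁻¹)
              * (LatticeBosons.numberMoment (LatticeBosons.latticeBall Λ R) 1 ψ₀
                + LatticeBosons.numberMoment (LatticeBosons.latticeBall Λ R) p ψ₀)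
            + ENNReal.ofReal (C * (lam + lam ^ p)) := by
  classical
  rcases lt_or_ge κ 0 with hκ | hκ
  · -- the first moment of a hopping matrix is never negative
    exact ⟨1, one_pos, fun Λ _ J _ _ hJκ => absurd
      (LatticeBosons.hoppingSpeed_nonneg Λ J) (by linarith)⟩
  have hv0 : 0 < v := by linarith
  obtain ⟨b, hb, hbd, hbα⟩ := LatticeBosons.exists_exponent hd hp hα
  have hp0 : (0 : ℝ) < p := by exact_mod_cast hp
  have hp1 : (1 : ℝ) ≤ p := by exact_mod_cast hp
  -- an intermediate speed leaves a gap of width proportional to `R - r` for the step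
  set w : ℝ := (κ + v) / 2
  have hκw : κ < w := by simp only [w]; linarith
  have hwv : w < v := by simp only [w]; linarith
  set ε : ℝ := 1 - w / v
  have hε : 0 < ε := by simp only [ε]; rw [sub_pos, div_lt_one hv0]; exact hwv
  have hθ : 1 < 1 + (w - κ) / (2 * (κ + 1)) := by
    have : 0 < (w - κ) / (2 * (κ + 1)) := div_pos (by linarith) (by linarith)
    linarith
  obtain ⟨C₁, hC₁, hprof⟩ := LatticeBosons.exists_profile_increment_bound hb hp hθ
  obtain ⟨L, hL, hscale⟩ := LatticeBosons.exists_scale d hC_J hκ hκw hC₁ (k := p * b + 1)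
    (by nlinarith) hbα
  have hL0 : 0 < L := by linarith
  -- `c` compares the distance to the step with the distance to the origin, outside `B_R`
  set c : ℝ := min 1 (ε / (2 * (1 + δ₀⁻¹)))
  have hc : 0 < c := lt_min one_pos (by positivity)
  have he : 0 ≤ ((p : ℝ) - 1) / p := div_nonneg (by linarith) hp0.le
  obtain ⟨K, hK, htail⟩ := LatticeBosons.exists_sum_profile_le d hb he hbd hc hL0
  set Q : ℝ := 2 * L / ε
  have hQ : 0 < Q := by positivity
  set C₂ : ℝ := (1 + (1 + Q)) ^ (2 * p)
  refine ⟨C₂ + 2 ^ (p - 1) * K ^ p, by positivity, ?_⟩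
  intro Λ hΛ J hJH hJ hJκ Φ lam R r hlam hR hr hRr ψ₀ _ hψ₀ ψ hψ hψ0
  set s : ℝ := R - r
  have hs1 : 1 < s := (le_max_right _ _).trans_lt hRr
  have hs0 : 0 < s := by linarith
  have hδs : δ₀ * r < s := (le_max_left _ _).trans_lt hRr
  have hRs : R ≤ (1 + δ₀⁻¹) * s := by
    have : r ≤ δ₀⁻¹ * s := by rw [inv_mul_eq_div, le_div_iff₀ hδ₀]; linarith
    have hRsr : R = s + r := by simp only [s]; ring
    linarith
  -- centre of the step at time `0`, inside `B_R`; it is still outside `B_r` at time `s / v`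
  set u₀ : ℝ := R - ε * s / 2
  set q : ℝ := ε * s / 2 / L
  have hq : 0 < q := by positivity
  refine iSup₂_le fun t ht => ?_
  have ht0 : 0 ≤ t := ht.1
  have hwt : w * t ≤ (1 - ε) * s := by
    have h1 : t * v ≤ s := (le_div_iff₀ hv0).mp ht.2.le
    have h2 : (1 - ε) * s = w / v * s := by simp only [ε]; ring
    have hw0 : 0 < w := by linarith
    calc w * t = w / v * (t * v) := by field_simp
      _ ≤ w / v * s := by gcongr
      _ = (1 - ε) * s := h2.symm
  set c₀ : ℝ := LatticeBosons.profile b (-q)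
  have hc₀ : 1 ≤ c₀ := by
    have h1 := LatticeBosons.rpow_neg_le_profile hb (-q)
    rwa [max_eq_right (by linarith), add_zero, Real.one_rpow] at h1
  -- the moment of the small ball at time `t` is below the weighted moment
  have hleft := LatticeBosons.ofReal_mul_numberMoment_le (c := c₀)
    (f := fun x : Λ => LatticeBosons.profile b
      ((‖(x : EuclideanSpace ℝ (Fin d))‖ + w * t - u₀) / L)) (by linarith)
    (fun x => (LatticeBosons.profile_pos hb _).le) (X := LatticeBosons.latticeBall Λ r)
    (fun x hx => LatticeBosons.profile_antitone hb (by
      have hxr : ‖(x : EuclideanSpace ℝ (Fin d))‖ ≤ r := by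
        simpa [LatticeBosons.latticeBall] using hx
      have : -q = -(ε * s / 2) / L := by simp only [q]; ring
      rw [this]
      gcongr
      simp only [u₀, s] at hwt ⊢
      linarith)) p (ψ t)
  have hevol := LatticeBosons.tsum_weightedNumber_le hJH hψ (u₀ := u₀) hb hL0 (by linarith)
    hC₁.le hprof (a := fun x : Λ => ‖(x : EuclideanSpace ℝ (Fin d))‖)
    (D := fun x y : Λ => dist x y)
    (fun x y => by
      rw [Subtype.dist_eq, dist_eq_norm]
      exact abs_norm_sub_norm_le _ _)
    (hscale Λ hΛ J hJ hJκ) ht0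
  -- only the on-site moments enter, so there is no power of the volume
  have hsite : ∀ x : Λ, LatticeBosons.numberMoment {x} p (ψ 0) ≤ ENNReal.ofReal (lam ^ p) := by
    intro x
    rw [hψ0]
    simpa using hψ₀ {x}
  have hout : ∑ x ∈ (LatticeBosons.latticeBall Λ R)ᶜ,
      LatticeBosons.profile b ((‖(x : EuclideanSpace ℝ (Fin d))‖ - u₀) / L) ≤
        K * s ^ (-(((p : ℝ) - 1) / p)) := by
    have hmem : ∀ x ∈ (LatticeBosons.latticeBall Λ R)ᶜ,
        R < ‖(x : EuclideanSpace ℝ (Fin d))‖ := fun x hx => by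
      simpa [LatticeBosons.latticeBall] using hx
    refine htail Λ hΛ _ s u₀ hs1.le (fun x hx => ?_) fun x hx => ?_
    · have := hmem x hx
      simp only [s]; linarith
    · have h1 := hmem x hx
      set ρ := ‖(x : EuclideanSpace ℝ (Fin d))‖
      have hc1 : c ≤ 1 := min_le_left _ _
      have h2 : c * R ≤ ε * s / 2 := by
        have h3 : c * R ≤ ε / (2 * (1 + δ₀⁻¹)) * ((1 + δ₀⁻¹) * s) :=
          mul_le_mul (min_le_right _ _) hRs hR.le (by positivity)
        refine h3.trans (le_of_eq ?_)
        field_simp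
      have h4 : c * (ρ - R) ≤ ρ - R := by nlinarith
      simp only [u₀]; linarith
  have hright := LatticeBosons.tsum_weightedNumber_le_add (X := LatticeBosons.latticeBall Λ R)
    (f := fun x : Λ => LatticeBosons.profile b ((‖(x : EuclideanSpace ℝ (Fin d))‖ - u₀) / L))
    (m := 2) (σ := s⁻¹) (fun x => (LatticeBosons.profile_pos hb _).le) zero_le_two
    (by positivity) (by positivity) (fun x _ => LatticeBosons.profile_le_two hb _) hout hp hsite
  have hmain := hleft.trans (hevol.trans hright)
  rw [hψ0, inv_inv] at hmain
  set MR := LatticeBosons.numberMoment (LatticeBosons.latticeBall Λ R) p ψ₀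
  set Mr := LatticeBosons.numberMoment (LatticeBosons.latticeBall Λ r) p (ψ t)
  -- the powers of `R - r` in the contribution of the outer sites cancel
  have htailpow : (1 + s) ^ (p - 1) * (K * s ^ (-(((p : ℝ) - 1) / p))) ^ p ≤
      2 ^ (p - 1) * K ^ p := by
    have h1 : (s ^ (-(((p : ℝ) - 1) / p))) ^ p = (s ^ (p - 1))⁻¹ := by
      rw [← Real.rpow_natCast, ← Real.rpow_mul hs0.le, neg_mul, div_mul_cancel₀ _ hp0.ne',
        Real.rpow_neg hs0.le, ← Real.rpow_natCast, Nat.cast_sub hp, Nat.cast_one]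
    have h2 : (1 + s) ^ (p - 1) ≤ 2 ^ (p - 1) * s ^ (p - 1) := by
      rw [← mul_pow]; gcongr; linarith
    rw [mul_pow, h1]
    calc (1 + s) ^ (p - 1) * (K ^ p * (s ^ (p - 1))⁻¹)
        ≤ 2 ^ (p - 1) * s ^ (p - 1) * (K ^ p * (s ^ (p - 1))⁻¹) := by gcongr
      _ = 2 ^ (p - 1) * K ^ p := by field_simp
  have hmainpow : (c₀ ^ p)⁻¹ * ((1 + s⁻¹) ^ (p - 1) * 2 ^ p) ≤ 1 + C₂ * s⁻¹ := by
    have hs' : s⁻¹ ≤ 1 := inv_le_one_of_one_le₀ hs1.le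
    have h1 : 2 / c₀ ≤ 1 + Q * s⁻¹ := by
      refine (LatticeBosons.two_div_profile_neg_le hb hq).trans (le_of_eq ?_)
      simp only [q, Q]; field_simp
    have hsi : 0 < s⁻¹ := by positivity
    have hQs : 0 < Q * s⁻¹ := by positivity
    have h2 : 1 + Q * s⁻¹ ≤ 1 + (1 + Q) * s⁻¹ := by linarith
    have h3 : 1 + s⁻¹ ≤ 1 + (1 + Q) * s⁻¹ := by linarith
    calc (c₀ ^ p)⁻¹ * ((1 + s⁻¹) ^ (p - 1) * 2 ^ p) = (1 + s⁻¹) ^ (p - 1) * (2 / c₀) ^ p := by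
          rw [div_pow]; ring
      _ ≤ (1 + (1 + Q) * s⁻¹) ^ (p - 1) * (1 + (1 + Q) * s⁻¹) ^ p := by
          have := h1.trans h2
          gcongr
      _ = (1 + (1 + Q) * s⁻¹) ^ (p - 1 + p) := (pow_add _ _ _).symm
      _ ≤ (1 + (1 + Q) * s⁻¹) ^ (2 * p) :=
          pow_le_pow_right₀ (by linarith) (by omega)
      _ ≤ 1 + C₂ * s⁻¹ :=
          LatticeBosons.one_add_mul_pow_le (by positivity) hsi.le hs' _
  have hc₀p : 1 ≤ c₀ ^ p := one_le_pow₀ hc₀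
  have hMr : Mr ≤ ENNReal.ofReal (1 + C₂ * s⁻¹) * MR +
      ENNReal.ofReal (2 ^ (p - 1) * K ^ p * lam ^ p) := by
    have h1 : Mr = ENNReal.ofReal (c₀ ^ p)⁻¹ * (ENNReal.ofReal (c₀ ^ p) * Mr) := by
      rw [← mul_assoc, ← ENNReal.ofReal_mul (by positivity), inv_mul_cancel₀ (by positivity),
        ENNReal.ofReal_one, one_mul]
    rw [h1]
    refine (mul_le_mul_right hmain _).trans ?_
    rw [mul_add, ← mul_assoc, ← ENNReal.ofReal_mul (by positivity),
      ← ENNReal.ofReal_mul (by positivity)]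
    refine add_le_add (mul_le_mul_left (ENNReal.ofReal_le_ofReal hmainpow) _)
      (ENNReal.ofReal_le_ofReal ?_)
    have h2 : (c₀ ^ p)⁻¹ ≤ 1 := inv_le_one_of_one_le₀ hc₀p
    calc (c₀ ^ p)⁻¹ * ((1 + s) ^ (p - 1) * (K * s ^ (-(((p : ℝ) - 1) / p))) ^ p * lam ^ p)
        ≤ 1 * (2 ^ (p - 1) * K ^ p * lam ^ p) := by gcongr
      _ = _ := one_mul _
  refine hMr.trans ?_
  rw [ENNReal.ofReal_add zero_le_one (by positivity), ENNReal.ofReal_one, add_mul, one_mul]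
  have hC₂ : 0 ≤ C₂ := by positivity
  have hKp : 0 ≤ 2 ^ (p - 1) * K ^ p := by positivity
  refine add_le_add (add_le_add le_rfl (mul_le_mul' (ENNReal.ofReal_le_ofReal ?_) le_add_self))
    (ENNReal.ofReal_le_ofReal ?_)
  · gcongr; linarith
  · have : 0 < lam ^ p := by positivity
    gcongr <;> linarith
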